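/- All graphs and tournaments are finite, and graphs are simple. For a tournament $T$, the dichromatic number $\vec\chi(T)$ is the least $k$ such that $V(T)$ can be partitioned into $k$ sets, each inducing an acyclic subtournament; for $A\subseteq V(T)$, $T[A]$ is the subtournament induced on $A$. The usual chromatic number and clique number of a graph $G$ are $\chi(G)$ and $\omega(G)$. Consider the following statements. (EE) (El-Zahar--Erdős conjecture) For all integers $t,c\ge 1$ there is $d\ge 1$ such that every graph $G$ with $\chi(G)\ge d$ and $\omega(G)<t$ has disjoint sets $A,B\subseteq V(G)$ with $\chi(G[A]),\chi(G[B])\ge c$ and no edges between $A$ and $B$. (NSS) (Nguyen--Scott--Seymour conjecture) For every integer $c\ge 0$ there is $d\ge 0$ such that every tournament $T$ with $\vec\chi(T)\ge d$ has disjoint sets $A,B\subseteq V(T)$ with $\vec\chi(T[A]),\vec\chi(T[B])\ge c$ such that all arcs between $A$ and $B$ go from $A$ to $B$. (NSS$_s$), for a function $s:\mathbb N\to\mathbb N$: there is a function $\mathrm{nss}:\mathbb N\times\mathbb N\to\mathbb N$ such that for all integers $t,c\ge 1$ and every tournament $T$, if $T$ has no set $S$ of at most $s(t)$ vertices with $\vec\chi(T[S])\ge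 t$, and $T$ has no disjoint sets $A,B\subseteq V(T)$ with $\vec\chi(T[A]),\vec\chi(T[B])\ge c$ such that all arcs between $A$ and $B$ go from $A$ to $B$, then $\vec\chi(T)\le \mathrm{nss}(t,c)$. Then (EE) implies (NSS), and conversely (NSS) implies (EE), so that the two conjectures are equivalent. Moreover, for every $s:\mathbb N\to\mathbb N$ with $s(x)\ge x^2 s(x-1)+x$ for all $x\ge 1$, (EE) is equivalent to (NSS$_s$). -/

import Mathlib

namespace Digraph

/-- A tournament: no loops, and exactly one of the two arcs between any two distinct vertices. -/
def IsTournament {V : Type*} (D : Digraph V) : Prop :=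
  (∀ v, ¬ D.Adj v v) ∧ ∀ u v, u ≠ v → Xor (D.Adj u v) (D.Adj v u)

/-- The subdigraph `D[S]` induced on the vertex set `S`. -/
def induce {V : Type*} (D : Digraph V) (S : Set V) : Digraph S where
  Adj u v := D.Adj u v

/-- A digraph is acyclic if no vertex can be reached from itself by following one or more arcs,
that is, if it has no directed cycle. -/
def IsAcyclic {V : Type*} (D : Digraph V) : Prop :=
  ∀ v, ¬ Relation.TransGen D.Adj v v

/-- The vertex set of `D` can be partitioned into at most `k` sets, each inducing an acyclic
digraph. -/
def Dicolorable {V : Type*} (D : Digraph V) (k : ℕ) : Prop :=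
  ∃ f : V → Fin k, ∀ i, (D.induce {v | f v = i}).IsAcyclic

/-- The dichromatic number: the least `k` such that `D` is `k`-dicolorable (`⊤` if there is none,
which does not happen for a finite loopless digraph). -/
noncomputable def dichromaticNumber {V : Type*} (D : Digraph V) : ℕ∞ :=
  ⨅ k ∈ {k : ℕ | D.Dicolorable k}, (k : ℕ∞)

/-- There are vertex sets `A` and `B`, each inducing dichromatic number at least `c`, with an arc
from every vertex of `A` to every vertex of `B`. In a tournament this says that `A` and `B` are
disjoint and that all arcs between them go from `A` to `B`. -/
def HasCompletePair {V : Type*} (D : Digraph V) (c : ℕ) : Prop :=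
  ∃ A B : Set V, (c : ℕ∞) ≤ (D.induce A).dichromaticNumber ∧
    (c : ℕ∞) ≤ (D.induce B).dichromaticNumber ∧ ∀ a ∈ A, ∀ b ∈ B, D.Adj a b

/-- A `(t, l)`-cluster: a set of at most `l` vertices inducing dichromatic number at least `t`. -/
def IsCluster {V : Type*} (D : Digraph V) (t l : ℕ) (S : Set V) : Prop :=
  S.Finite ∧ S.ncard ≤ l ∧ (t : ℕ∞) ≤ (D.induce S).dichromaticNumber

end Digraph

/-- The El-Zahar–Erdős conjecture, for finite graphs. -/
def ElZaharErdosConjecture : Prop :=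
  ∀ t c : ℕ, 1 ≤ t → 1 ≤ c → ∃ d : ℕ, 1 ≤ d ∧
    ∀ (V : Type) [Finite V] (G : SimpleGraph V),
      (d : ℕ∞) ≤ G.chromaticNumber → G.CliqueFree t →
        ∃ A B : Set V, (c : ℕ∞) ≤ (G.induce A).chromaticNumber ∧
          (c : ℕ∞) ≤ (G.induce B).chromaticNumber ∧
          Disjoint A B ∧ ∀ a ∈ A, ∀ b ∈ B, ¬ G.Adj a b

/-- The Nguyen–Scott–Seymour conjecture, for finite tournaments. -/
def NguyenScottSeymourConjecture : Prop :=
  ∀ c : ℕ, ∃ d : ℕ, ∀ (V : Type) [Finite V] (T : Digraph V), T.IsTournament →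
    (d : ℕ∞) ≤ T.dichromaticNumber → T.HasCompletePair c

/-- The cluster form of the Nguyen–Scott–Seymour conjecture, where a `t`-cluster is a
`(t, s t)`-cluster. -/
def ClusterFreeConjecture (s : ℕ → ℕ) : Prop :=
  ∃ nss : ℕ → ℕ → ℕ, ∀ t c : ℕ, 1 ≤ t → 1 ≤ c →
    ∀ (V : Type) [Finite V] (T : Digraph V), T.IsTournament →
      (¬ ∃ S : Set V, T.IsCluster t (s t) S) → ¬ T.HasCompletePair c →
        T.dichromaticNumber ≤ (nss t c : ℕ∞)

open Set

/-! The implications form a cycle: (EE) gives (NSS), (NSS) gives (NSS$_s$) at once, and (NSS$_s$)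
gives (EE).

From (NSS$_s$) to (EE): order the vertices of a graph and reverse the arcs along its edges.
Independent sets become acyclic, and on an acyclic set adjacency is transitive along the order, so χ
and the dichromatic number agree up to a factor bounded by the clique number. By induction on `t`
neighbourhoods have small χ. A cluster then gives an anticomplete pair directly, while a complete
pair can be cut at one vertex to give an anticomplete one
(`SimpleGraph.hasAnticompletePair_of_backArc`).

From (EE) to (NSS): by induction on `t`, tournaments without small `t`-clusters and without complete
pairs have bounded dichromatic number (`exists_dichi_le_of_not_hasCluster`). Call an arc heavy if
the vertices completing it to a directed triangle have large dichromatic number. A large clique of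
heavy arcs would build a cluster, so (EE) applies to the heavy graph. If its χ is small, its colour
classes contain only light arcs and are bounded by `IsTour.dichi_le_of_arcNbhd`; if large, (EE)
gives two sets with only light arcs between them, and `IsTour.hasPair_of_isLightBetween` finds a
complete pair. Both use that without clusters every set has a small dominating set. Finally, a
bounded-size `2c`-cluster sorts the other vertices into boundedly many types, each small. -/

/-- A family of vertex sets that is closed under subsets and contains all subsingletons. -/
structure IsHereditary {V : Type*} (P : Set V → Prop) : Prop where
  mono : ∀ ⦃A B : Set V⦄, A ⊆ B → P B → P A
  subsingleton : ∀ ⦃A : Set V⦄, A.Subsingleton → P A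

/-- `f` splits `X` into `k` sets of the family `P`. -/
def IsCovering {V : Type*} (P : Set V → Prop) (X : Set V) (k : ℕ) (f : V → ℕ) : Prop :=
  (∀ x ∈ X, f x < k) ∧ ∀ i, P {x | x ∈ X ∧ f x = i}

/-- The least number of sets of the family `P` into which `X` can be split. -/
noncomputable def coverNumber {V : Type*} (P : Set V → Prop) (X : Set V) : ℕ :=
  sInf {k | ∃ f, IsCovering P X k f}

/-! ### Covering numbers of hereditary set families, common to χ and the dichromatic number -/

section coverNumber

variable {V : Type*} {P Q : Set V → Prop} {X Y : Set V} {k n : ℕ} {f : V → ℕ}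

theorem IsCovering.coverNumber_le (h : IsCovering P X k f) : coverNumber P X ≤ k :=
  Nat.sInf_le ⟨f, h⟩

theorem IsHereditary.exists_isCovering [Finite V] (hP : IsHereditary P) (X : Set V) :
    ∃ f, IsCovering P X (coverNumber P X) f := by
  have : {k | ∃ f, IsCovering P X k f}.Nonempty := by
    obtain ⟨n, ⟨e⟩⟩ := Finite.exists_equiv_fin V
    refine ⟨n, fun v => (e v : ℕ), fun x _ => (e x).2, fun i => hP.subsingleton ?_⟩
    rintro x ⟨_, hx⟩ y ⟨_, hy⟩
    exact e.injective (Fin.ext (hx.trans hy.symm))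
  exact Nat.sInf_mem this

theorem IsCovering.mono (hP : IsHereditary P) (hXY : X ⊆ Y) (h : IsCovering P Y k f) :
    IsCovering P X k f :=
  ⟨fun x hx => h.1 x (hXY hx), fun i => hP.mono (ofPred_subset_ofPred.2 fun _ hx =>
    ⟨hXY hx.1, hx.2⟩) (h.2 i)⟩

theorem IsHereditary.coverNumber_mono [Finite V] (hP : IsHereditary P) (hXY : X ⊆ Y) :
    coverNumber P X ≤ coverNumber P Y := by
  obtain ⟨f, hf⟩ := hP.exists_isCovering Y
  exact (hf.mono hP hXY).coverNumber_le

theorem IsHereditary.coverNumber_union_le [Finite V] (hP : IsHereditary P) (X Y : Set V) :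
    coverNumber P (X ∪ Y) ≤ coverNumber P X + coverNumber P Y := by
  classical
  obtain ⟨f, hf⟩ := hP.exists_isCovering X
  obtain ⟨g, hg⟩ := hP.exists_isCovering Y
  refine IsCovering.coverNumber_le (f := fun v => if v ∈ X then f v else coverNumber P X + g v)
    ⟨fun x hx => ?_, fun i => ?_⟩
  · by_cases h : x ∈ X
    · simp only [h, if_true]
      have := hf.1 x h
      omega
    · simp only [h, if_false]
      have := hg.1 x (hx.resolve_left h)
      omega
  · rcases lt_or_ge i (coverNumber P X) with hi | hi
    · refine hP.mono ?_ (hf.2 i)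
      rintro x ⟨_, hx⟩
      by_cases h : x ∈ X
      · simp only [h, if_true] at hx
        exact ⟨h, hx⟩
      · simp only [h, if_false] at hx
        omega
    · refine hP.mono ?_ (hg.2 (i - coverNumber P X))
      rintro x ⟨hxX, hx⟩
      by_cases h : x ∈ X
      · simp only [h, if_true] at hx
        have := hf.1 x h
        omega
      · simp only [h, if_false] at hx
        exact ⟨hxX.resolve_left h, by omega⟩

theorem IsHereditary.coverNumber_le_add [Finite V] (hP : IsHereditary P) {A B : Set V}
    (h : X ⊆ A ∪ B) : coverNumber P X ≤ coverNumber P A + coverNumber P B :=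
  (hP.coverNumber_mono h).trans (hP.coverNumber_union_le A B)

theorem IsHereditary.coverNumber_le_one (hP : IsHereditary P) (hX : P X) :
    coverNumber P X ≤ 1 :=
  IsCovering.coverNumber_le (f := fun _ => 0)
    ⟨fun _ _ => Nat.one_pos, fun _ => hP.mono (fun _ hx => hx.1) hX⟩

theorem IsHereditary.coverNumber_empty (hP : IsHereditary P) : coverNumber P ∅ = 0 :=
  Nat.le_zero.1 (IsCovering.coverNumber_le (f := fun _ => 0)
    ⟨fun _ h => h.elim, fun _ => hP.subsingleton fun _ h => h.1.elim⟩)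

theorem IsHereditary.nonempty_of_coverNumber_pos (hP : IsHereditary P)
    (h : 0 < coverNumber P X) : X.Nonempty := by
  rw [nonempty_iff_ne_empty]
  rintro rfl
  rw [hP.coverNumber_empty] at h
  exact h.false

theorem IsHereditary.coverNumber_biUnion_le [Finite V] (hP : IsHereditary P) {ι : Type*}
    (D : Finset ι) (S : ι → Set V) (h : ∀ i ∈ D, coverNumber P (S i) ≤ n) :
    coverNumber P (⋃ i ∈ D, S i) ≤ D.card * n := by
  classical
  induction D using Finset.induction_on with
  | empty => simp [hP.coverNumber_empty]
  | insert a D ha ih =>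
    rw [Finset.set_biUnion_insert, Finset.card_insert_of_notMem ha]
    have h1 := hP.coverNumber_union_le (S a) (⋃ i ∈ D, S i)
    have h2 := ih fun i hi => h i (Finset.mem_insert_of_mem hi)
    have h3 := h a (Finset.mem_insert_self a D)
    rw [add_mul, one_mul]
    omega

theorem IsHereditary.coverNumber_le_card [Finite V] (hP : IsHereditary P) (D : Finset V) :
    coverNumber P (D : Set V) ≤ D.card := by
  have h := hP.coverNumber_biUnion_le (n := 1) D (fun v => {v})
    fun i _ => hP.coverNumber_le_one (hP.subsingleton subsingleton_singleton)
  rw [mul_one] at h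
  refine (hP.coverNumber_mono ?_).trans h
  intro x hx
  simpa using hx

theorem IsHereditary.coverNumber_le_card_mul [Finite V] (hP : IsHereditary P) {ι : Type*}
    (D : Finset ι) (S : ι → Set V) (hX : ∀ x ∈ X, ∃ i ∈ D, x ∈ S i)
    (h : ∀ i ∈ D, coverNumber P (S i) ≤ n) : coverNumber P X ≤ D.card * n := by
  refine (hP.coverNumber_mono fun x hx => ?_).trans (hP.coverNumber_biUnion_le D S h)
  obtain ⟨i, hi, hxi⟩ := hX x hx
  exact mem_biUnion hi hxi

theorem IsHereditary.coverNumber_le_mul [Finite V] (hP : IsHereditary P) (hQ : IsHereditary Q)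
    (h : ∀ Y ⊆ X, P Y → coverNumber Q Y ≤ n) :
    coverNumber Q X ≤ coverNumber P X * n := by
  obtain ⟨f, hf⟩ := hP.exists_isCovering X
  have := hQ.coverNumber_le_card_mul (X := X) (n := n) (Finset.range (coverNumber P X))
    (fun i => {x | x ∈ X ∧ f x = i})
    (fun x hx => ⟨f x, Finset.mem_range.2 (hf.1 x hx), hx, rfl⟩)
    (fun i _ => h _ (fun _ hx => hx.1) (hf.2 i))
  rwa [Finset.card_range] at this

/-- All fibres of `g` are coloured independently with the same palette. -/
theorem IsHereditary.coverNumber_le_of_fibers [Finite V] (hP : IsHereditary P) {ι : Type*}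
    (g : V → ι) (hg : ∀ Y ⊆ X, (∀ i, P {x | x ∈ Y ∧ g x = i}) → P Y)
    (h : ∀ i, coverNumber P {x | x ∈ X ∧ g x = i} ≤ n) : coverNumber P X ≤ n := by
  choose F hF using fun i => hP.exists_isCovering {x | x ∈ X ∧ g x = i}
  refine IsCovering.coverNumber_le (f := fun v => F (g v) v) ⟨fun x hx => ?_, fun j => ?_⟩
  · exact ((hF (g x)).1 x ⟨hx, rfl⟩).trans_le (h _)
  · refine hg _ (fun x hx => hx.1) fun i => hP.mono ?_ ((hF i).2 j)
    rintro x ⟨⟨hx, hxj⟩, rfl⟩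
    exact ⟨⟨hx, rfl⟩, hxj⟩

/-- If `g` is a level function such that a set is in the family as soon as all its levels are,
provided all levels have the same parity, then twice the bound for the levels suffices. -/
theorem IsHereditary.coverNumber_le_of_levels [Finite V] (hP : IsHereditary P)
    (g : V → ℕ) (hg : ∀ Y ⊆ X, (∀ x ∈ Y, ∀ y ∈ Y, g x % 2 = g y % 2) →
      (∀ i, P {x | x ∈ Y ∧ g x = i}) → P Y)
    (h : ∀ i, coverNumber P {x | x ∈ X ∧ g x = i} ≤ n) : coverNumber P X ≤ 2 * n := by
  have key : ∀ e, coverNumber P {x | x ∈ X ∧ g x % 2 = e} ≤ n := by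
    intro e
    refine hP.coverNumber_le_of_fibers g (fun Y hY hi => ?_) fun i => ?_
    · refine hg Y (fun x hx => (hY hx).1) (fun x hx y hy => ?_) hi
      rw [(hY hx).2, (hY hy).2]
    · exact (hP.coverNumber_mono (ofPred_subset_ofPred.2 fun x hx => ⟨hx.1.1, hx.2⟩)).trans (h i)
  have := hP.coverNumber_le_card_mul (X := X) (n := n) (Finset.range 2)
    (fun e => {x | x ∈ X ∧ g x % 2 = e})
    (fun x hx => ⟨g x % 2, Finset.mem_range.2 (Nat.mod_lt _ two_pos), hx, rfl⟩)
    (fun e _ => key e)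
  rwa [Finset.card_range] at this

/-- If a colour were missing, the last colour could be renamed to it. Applied to a subset needing
all `k` colours of an ambient colouring, this finds a vertex of any prescribed colour, which is how
the clusters below produce monochromatic triangles. -/
theorem IsCovering.exists_eq (hP : IsHereditary P) (hf : IsCovering P X k f)
    (hk : k ≤ coverNumber P X) {i : ℕ} (hi : i < k) : ∃ x ∈ X, f x = i := by
  by_contra! hne
  have : coverNumber P X ≤ k - 1 := by
    refine IsCovering.coverNumber_le (f := fun v => if f v = k - 1 then i else f v)
      ⟨fun x hx => ?_, fun j => ?_⟩
    · have h1 := hf.1 x hx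
      have h2 := hne x hx
      dsimp only
      split_ifs with h <;> omega
    · refine hP.mono ?_ (hf.2 (if j = i then k - 1 else j))
      rintro x ⟨hx, hxj⟩
      have h2 := hne x hx
      refine ⟨hx, ?_⟩
      dsimp only at hxj
      split_ifs at hxj ⊢ <;> omega
  omega

theorem IsHereditary.preimage_val (hP : IsHereditary P) (X : Set V) :
    IsHereditary fun S : Set X => P (Subtype.val '' S) :=
  ⟨fun _ _ h => hP.mono (image_mono h), fun _ h => hP.subsingleton (h.image _)⟩

theorem IsHereditary.coverNumber_subtype [Finite V] (hP : IsHereditary P) (X : Set V)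
    (S : Set X) :
    coverNumber (fun S : Set X => P (Subtype.val '' S)) S =
      coverNumber P (Subtype.val '' S) := by
  classical
  apply le_antisymm
  · obtain ⟨f, hf⟩ := hP.exists_isCovering (Subtype.val '' S)
    refine IsCovering.coverNumber_le (f := fun v => f v)
      ⟨fun x hx => hf.1 _ (mem_image_of_mem _ hx), fun i => hP.mono ?_ (hf.2 i)⟩
    rintro _ ⟨x, ⟨hx, hi⟩, rfl⟩
    exact ⟨mem_image_of_mem _ hx, hi⟩
  · obtain ⟨f, hf⟩ := (hP.preimage_val X).exists_isCovering S
    refine IsCovering.coverNumber_le (f := fun v => if h : v ∈ X then f ⟨v, h⟩ else 0)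
      ⟨?_, fun i => hP.mono ?_ (hf.2 i)⟩
    · rintro _ ⟨x, hx, rfl⟩
      simpa using hf.1 x hx
    · rintro _ ⟨⟨x, hx, rfl⟩, hi⟩
      exact ⟨x, ⟨hx, by simpa using hi⟩, rfl⟩

end coverNumber

/-! ### Tournaments and directed triangles -/

/-- The arc relation of a tournament. -/
structure IsTour {V : Type*} (r : V → V → Prop) : Prop where
  asymm : ∀ ⦃u v⦄, r u v → ¬ r v u
  total : ∀ ⦃u v⦄, u ≠ v → r u v ∨ r v u

/-- The set `X` spans no directed triangle. -/
def TriangleFree {V : Type*} (r : V → V → Prop) (X : Set V) : Prop :=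
  ∀ a ∈ X, ∀ b ∈ X, ∀ c ∈ X, r a b → r b c → ¬ r c a

/-- The least number of sets without directed triangles into which `X` can be split. For a
tournament this is the dichromatic number of `X`. -/
noncomputable abbrev dichi {V : Type*} (r : V → V → Prop) (X : Set V) : ℕ :=
  coverNumber (TriangleFree r) X

/-- The vertices that form a directed triangle with the arc `u v`. -/
def arcNbhd {V : Type*} (r : V → V → Prop) (u v : V) : Set V := {z | r v z ∧ r z u}

/-- There is a complete pair of sets of dichromatic number at least `c`. -/
def HasPair {V : Type*} (r : V → V → Prop) (c : ℕ) : Prop :=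
  ∃ A B : Set V, c ≤ dichi r A ∧ c ≤ dichi r B ∧ ∀ a ∈ A, ∀ b ∈ B, r a b

section Tour

variable {V : Type*} {r : V → V → Prop} {X Y : Set V}

theorem IsTour.irrefl (hr : IsTour r) (v : V) : ¬ r v v := fun h => hr.asymm h h

theorem IsTour.ne (hr : IsTour r) {u v : V} (h : r u v) : u ≠ v := by
  rintro rfl
  exact hr.irrefl _ h

theorem IsTour.swap (hr : IsTour r) : IsTour (Function.swap r) :=
  ⟨fun _ _ h => hr.asymm h, fun _ _ h => hr.total h.symm⟩

theorem IsTour.hereditary (hr : IsTour r) : IsHereditary (TriangleFree r) := by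
  refine ⟨fun A B h hB a ha b hb c hc => hB a (h ha) b (h hb) c (h hc), ?_⟩
  intro A hA a ha b hb c _ hab
  rw [hA ha hb] at hab
  exact (hr.irrefl _ hab).elim

theorem triangleFree_swap : TriangleFree (Function.swap r) = TriangleFree r := by
  funext X
  refine propext ⟨fun h a ha b hb c hc h1 h2 h3 => ?_, fun h a ha b hb c hc h1 h2 h3 => ?_⟩
  · exact h c hc b hb a ha h2 h1 h3
  · exact h c hc b hb a ha h2 h1 h3

theorem dichi_swap : dichi (Function.swap r) X = dichi r X := by
  rw [dichi, triangleFree_swap]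

theorem arcNbhd_swap (u v : V) : arcNbhd (Function.swap r) u v = arcNbhd r v u := by
  ext z
  exact and_comm

theorem HasPair.of_swap {c : ℕ} (h : HasPair (Function.swap r) c) : HasPair r c := by
  obtain ⟨A, B, hA, hB, hAB⟩ := h
  rw [dichi_swap] at hA hB
  exact ⟨B, A, hB, hA, fun b hb a ha => hAB a ha b hb⟩

theorem TriangleFree.trans (hr : IsTour r) (hX : TriangleFree r X) {a b c : V} (ha : a ∈ X)
    (hb : b ∈ X) (hc : c ∈ X) (hab : r a b) (hbc : r b c) : r a c := by
  refine (hr.total ?_).resolve_right (hX a ha b hb c hc hab hbc)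
  rintro rfl
  exact hr.asymm hab hbc

/-- The vertices are split by `g` into classes, each bounded, with every directed triangle inside
one class. -/
theorem IsTour.dichi_le_of_fibers [Finite V] (hr : IsTour r) {ι : Type*} {n : ℕ} (g : V → ι)
    (hg : ∀ a ∈ X, ∀ b ∈ X, ∀ c ∈ X, r a b → r b c → r c a → g a = g b)
    (h : ∀ i, dichi r {x | x ∈ X ∧ g x = i} ≤ n) : dichi r X ≤ n := by
  refine hr.hereditary.coverNumber_le_of_fibers g (fun Y hY hi a ha b hb c hc h1 h2 h3 => ?_) h
  have e1 := hg a (hY ha) b (hY hb) c (hY hc) h1 h2 h3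
  have e2 := hg c (hY hc) a (hY ha) b (hY hb) h3 h1 h2
  exact hi (g a) a ⟨ha, rfl⟩ b ⟨hb, e1.symm⟩ c ⟨hc, e2⟩ h1 h2 h3

/-- A level function that increases by at most one along each arc. -/
theorem IsTour.dichi_le_of_levels [Finite V] (hr : IsTour r) {n : ℕ} (g : V → ℕ)
    (hg : ∀ a ∈ X, ∀ b ∈ X, r a b → g b ≤ g a + 1)
    (h : ∀ i, dichi r {x | x ∈ X ∧ g x = i} ≤ n) : dichi r X ≤ 2 * n := by
  refine hr.hereditary.coverNumber_le_of_levels g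
    (fun Y hY hp hi a ha b hb c hc h1 h2 h3 => ?_) h
  -- With equal parities a rise of at most one is no rise, so the level is constant around a
  -- triangle.
  have e1 := hg a (hY ha) b (hY hb) h1
  have e2 := hg b (hY hb) c (hY hc) h2
  have e3 := hg c (hY hc) a (hY ha) h3
  have p1 := hp a ha b hb
  have p2 := hp a ha c hc
  exact hi (g a) a ⟨ha, rfl⟩ b ⟨hb, by omega⟩ c ⟨hc, by omega⟩ h1 h2 h3

end Tour

/-! ### Passing from (di)chromatic numbers to covering numbers -/

section Translation

variable {V : Type*}

theorem Digraph.IsTournament.isTour {T : Digraph V} (hT : T.IsTournament) : IsTour T.Adj := by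
  refine ⟨fun u v h h' => ?_, fun u v h => (hT.2 u v h).or⟩
  rcases eq_or_ne u v with rfl | huv
  · exact hT.1 _ h
  · rcases hT.2 u v huv with h1 | h1
    · exact h1.2 h'
    · exact h1.2 h

theorem Digraph.isAcyclic_induce_iff {T : Digraph V} (hT : T.IsTournament) (X : Set V) :
    (T.induce X).IsAcyclic ↔ TriangleFree T.Adj X := by
  have hr := hT.isTour
  constructor
  · intro h a ha b hb c hc h1 h2 h3
    refine h ⟨a, ha⟩ (Relation.TransGen.trans (b := ⟨c, hc⟩)
      (Relation.TransGen.trans (b := ⟨b, hb⟩) ?_ ?_) ?_)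
    · exact Relation.TransGen.single h1
    · exact Relation.TransGen.single h2
    · exact Relation.TransGen.single h3
  · intro h
    have key : ∀ u v : X, Relation.TransGen (T.induce X).Adj u v → T.Adj u v := by
      intro u v huv
      induction huv with
      | single h1 => exact h1
      | tail _ h1 ih => exact h.trans hr u.2 (Subtype.prop _) (Subtype.prop _) ih h1
    exact fun v hv => hT.1 _ (key v v hv)

theorem Digraph.IsTournament.induce {T : Digraph V} (hT : T.IsTournament) (X : Set V) :
    (T.induce X).IsTournament :=
  ⟨fun v => hT.1 v, fun u v h => hT.2 u v fun h' => h (Subtype.ext h')⟩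

theorem Digraph.IsTournament.dicolorable_iff {T : Digraph V} (hT : T.IsTournament) (k : ℕ) :
    T.Dicolorable k ↔ ∃ f, IsCovering (TriangleFree T.Adj) univ k f := by
  constructor
  · rintro ⟨f, hf⟩
    refine ⟨fun v => f v, fun v _ => (f v).2, fun i a ha b hb c hc => ?_⟩
    refine (Digraph.isAcyclic_induce_iff hT _).1 (hf (f a)) a rfl b ?_ c ?_
    · exact Fin.ext (hb.2.trans ha.2.symm)
    · exact Fin.ext (hc.2.trans ha.2.symm)
  · rintro ⟨f, hf⟩
    refine ⟨fun v => ⟨f v, hf.1 v trivial⟩, fun i => (Digraph.isAcyclic_induce_iff hT _).2 ?_⟩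
    refine hT.isTour.hereditary.mono ?_ (hf.2 i)
    rintro v rfl
    exact ⟨trivial, rfl⟩

theorem Digraph.IsTournament.dichromaticNumber_eq [Finite V] {T : Digraph V}
    (hT : T.IsTournament) : T.dichromaticNumber = (dichi T.Adj univ : ℕ∞) := by
  apply le_antisymm
  · exact iInf₂_le (dichi T.Adj univ)
      ((hT.dicolorable_iff _).2 (hT.isTour.hereditary.exists_isCovering univ))
  · refine le_iInf₂ fun k hk => ?_
    obtain ⟨f, hf⟩ := (hT.dicolorable_iff k).1 hk
    exact_mod_cast hf.coverNumber_le

theorem triangleFree_subtype (r : V → V → Prop) (X : Set V) :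
    TriangleFree (fun a b : X => r a b) = fun S => TriangleFree r (Subtype.val '' S) := by
  funext S
  simp only [TriangleFree, forall_mem_image]

theorem dichi_subtype [Finite V] {r : V → V → Prop} (hr : IsTour r) (X : Set V) (S : Set X) :
    dichi (fun a b : X => r a b) S = dichi r (Subtype.val '' S) := by
  rw [dichi, triangleFree_subtype, hr.hereditary.coverNumber_subtype]

theorem Digraph.IsTournament.dichromaticNumber_induce [Finite V] {T : Digraph V}
    (hT : T.IsTournament) (X : Set V) :
    (T.induce X).dichromaticNumber = (dichi T.Adj X : ℕ∞) := by
  rw [(hT.induce X).dichromaticNumber_eq]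
  have := dichi_subtype hT.isTour X univ
  rw [image_univ, Subtype.range_coe] at this
  rw [← this]
  rfl

theorem Digraph.IsTournament.hasCompletePair_iff [Finite V] {T : Digraph V}
    (hT : T.IsTournament) (c : ℕ) : T.HasCompletePair c ↔ HasPair T.Adj c := by
  simp only [Digraph.HasCompletePair, HasPair, hT.dichromaticNumber_induce, Nat.cast_le]

/-- The chromatic number of the subgraph of `G` induced on `X`. -/
noncomputable abbrev chiOn (G : SimpleGraph V) (X : Set V) : ℕ := coverNumber G.IsIndepSet X

theorem SimpleGraph.hereditary_isIndepSet (G : SimpleGraph V) : IsHereditary G.IsIndepSet :=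
  ⟨fun _ _ h hB => hB.mono h, fun _ h => h.pairwise _⟩

theorem SimpleGraph.chromaticNumber_eq_chiOn [Finite V] (G : SimpleGraph V) :
    G.chromaticNumber = (chiOn G univ : ℕ∞) := by
  apply le_antisymm
  · rw [SimpleGraph.chromaticNumber_le_iff_colorable]
    obtain ⟨f, hf⟩ := G.hereditary_isIndepSet.exists_isCovering univ
    refine ⟨SimpleGraph.Coloring.mk (fun v => ⟨f v, hf.1 v trivial⟩) fun {u v} huv h => ?_⟩
    exact hf.2 (f v) ⟨trivial, Fin.ext_iff.1 h⟩ ⟨trivial, rfl⟩ huv.ne huv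
  · refine SimpleGraph.le_chromaticNumber_iff_colorable.2 fun k hk => ?_
    obtain ⟨C⟩ := hk
    have : chiOn G univ ≤ k := IsCovering.coverNumber_le (f := fun v => C v)
      ⟨fun v _ => (C v).2, fun i u hu v hv _ huv => C.valid huv (Fin.ext (hu.2.trans hv.2.symm))⟩
    exact_mod_cast this

theorem SimpleGraph.chiOn_induce [Finite V] (G : SimpleGraph V) (X : Set V) (S : Set X) :
    chiOn (G.induce X) S = chiOn G (Subtype.val '' S) := by
  have : (G.induce X).IsIndepSet = fun S => G.IsIndepSet (Subtype.val '' S) := by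
    funext S
    simp [SimpleGraph.IsIndepSet, Set.Pairwise, Subtype.ext_iff]
  rw [chiOn, this, G.hereditary_isIndepSet.coverNumber_subtype]

theorem SimpleGraph.chromaticNumber_induce_eq_chiOn [Finite V] (G : SimpleGraph V) (X : Set V) :
    (G.induce X).chromaticNumber = (chiOn G X : ℕ∞) := by
  rw [SimpleGraph.chromaticNumber_eq_chiOn, SimpleGraph.chiOn_induce, image_univ,
    Subtype.range_coe]

end Translation

/-! ### From the cluster form to the El-Zahar–Erdős conjecture -/

section Graph

variable {V : Type*}

/-- There are disjoint sets of chromatic number at least `c` without edges between them. -/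
def SimpleGraph.HasAnticompletePair (G : SimpleGraph V) (c : ℕ) : Prop :=
  ∃ A B : Set V, c ≤ chiOn G A ∧ c ≤ chiOn G B ∧ Disjoint A B ∧ ∀ a ∈ A, ∀ b ∈ B, ¬ G.Adj a b

/-- Graphs without cliques of size `t` and with chromatic number at least `d` have a pair of
anticomplete sets of chromatic number at least `c`. -/
def IsErdosBound (t c d : ℕ) : Prop :=
  ∀ (V : Type) [Finite V] (G : SimpleGraph V), G.CliqueFree t → d ≤ chiOn G univ →
    G.HasAnticompletePair c

theorem elZaharErdosConjecture_iff :
    ElZaharErdosConjecture ↔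
      ∀ t c : ℕ, 1 ≤ t → 1 ≤ c → ∃ d : ℕ, 1 ≤ d ∧ IsErdosBound t c d := by
  have (t c d : ℕ) : IsErdosBound t c d ↔ ∀ (V : Type) [Finite V] (G : SimpleGraph V),
      (d : ℕ∞) ≤ G.chromaticNumber → G.CliqueFree t →
        ∃ A B : Set V, (c : ℕ∞) ≤ (G.induce A).chromaticNumber ∧
          (c : ℕ∞) ≤ (G.induce B).chromaticNumber ∧
          Disjoint A B ∧ ∀ a ∈ A, ∀ b ∈ B, ¬ G.Adj a b := by
    refine forall₃_congr fun V _ G => ?_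
    simp only [SimpleGraph.chromaticNumber_induce_eq_chiOn, Nat.cast_le]
    rw [SimpleGraph.chromaticNumber_eq_chiOn, Nat.cast_le]
    exact ⟨fun h h1 h2 => h h2 h1, fun h h1 h2 => h h2 h1⟩
  simp only [this]
  rfl

theorem IsErdosBound.chiOn_lt {V : Type} [Finite V] {G : SimpleGraph V} {t c d : ℕ}
    (h : IsErdosBound t c d) (hG : ¬ G.HasAnticompletePair c) {X : Set V}
    (hX : (G.induce X).CliqueFree t) : chiOn G X < d := by
  by_contra! hd
  obtain ⟨A, B, hA, hB, hAB, h0⟩ := h X (G.induce X) hX (by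
    rwa [SimpleGraph.chiOn_induce, image_univ, Subtype.range_coe])
  rw [SimpleGraph.chiOn_induce] at hA hB
  refine hG ⟨_, _, hA, hB, (disjoint_image_iff Subtype.val_injective).2 hAB, ?_⟩
  rintro _ ⟨a, ha, rfl⟩ _ ⟨b, hb, rfl⟩
  exact h0 a ha b hb

theorem SimpleGraph.CliqueFree.induce_neighborSet {G : SimpleGraph V} {t : ℕ}
    (h : G.CliqueFree (t + 1)) (v : V) : (G.induce (G.neighborSet v)).CliqueFree t := by
  classical
  intro s hs
  have h1 : G.IsNClique t (s.map (Function.Embedding.subtype _)) := by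
    have := hs.map (f := Function.Embedding.subtype _)
    refine this.mono ?_
    exact SimpleGraph.map_comap_le _ _
  refine h _ (h1.insert (a := v) fun b hb => ?_)
  obtain ⟨⟨x, hx⟩, _, rfl⟩ := Finset.mem_map.1 hb
  exact hx

/-- If adjacency is transitive on `Y` along an ordering, then the chromatic number is at most
the clique number. -/
theorem SimpleGraph.chiOn_le_of_trans [Finite V] (G : SimpleGraph V) {f : V → ℕ}
    (hf : f.Injective) (t : ℕ) (Y : Set V)
    (htr : ∀ a ∈ Y, ∀ b ∈ Y, ∀ c ∈ Y, f a < f b → f b < f c → G.Adj a b → G.Adj b c → G.Adj a c)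
    (hfree : ∀ s : Finset V, (s : Set V) ⊆ Y → ¬ G.IsNClique (t + 1) s) : chiOn G Y ≤ t := by
  classical
  induction t generalizing Y with
  | zero =>
    have : Y = ∅ := by
      rw [eq_empty_iff_forall_notMem]
      intro y hy
      refine hfree {y} (by simpa using hy) ?_
      simp [SimpleGraph.isNClique_iff]
    subst this
    exact G.hereditary_isIndepSet.coverNumber_empty.le
  | succ t ih =>
    -- `M` consists of the minimal elements of the order given by adjacency. The lowest vertex of a
    -- clique outside `M` has an earlier neighbour, which extends the clique by transitivity, so
    -- removing `M` lowers the clique number.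
    set M : Set V := {y | y ∈ Y ∧ ∀ b ∈ Y, G.Adj b y → ¬ f b < f y} with hM
    have h1 : chiOn G M ≤ 1 := by
      refine G.hereditary_isIndepSet.coverNumber_le_one fun a ha b hb hab h => ?_
      rcases lt_or_gt_of_ne (hf.ne hab) with h2 | h2
      · exact hb.2 a ha.1 h h2
      · exact ha.2 b hb.1 h.symm h2
    have h2 : chiOn G (Y \ M) ≤ t := by
      refine ih (Y \ M) (fun a ha b hb c hc => htr a ha.1 b hb.1 c hc.1) fun s hs hcl => ?_
      have hne : s.Nonempty := by
        rw [← Finset.card_pos, hcl.card_eq]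
        omega
      obtain ⟨q, hq, hmin⟩ := s.exists_min_image f hne
      have hqM := (hs hq).2
      simp only [hM, mem_ofPred_eq, not_and, not_forall, not_not] at hqM
      obtain ⟨b, hb, hbq, hlt⟩ := hqM (hs hq).1
      refine hfree (insert b s) ?_ (hcl.insert fun x hx => ?_)
      · rw [Finset.coe_insert, insert_subset_iff]
        exact ⟨hb, fun x hx => (hs hx).1⟩
      · rcases eq_or_ne q x with rfl | hqx
        · exact hbq
        · exact htr b hb q (hs hq).1 x (hs hx).1 hlt
            (lt_of_le_of_ne (hmin x hx) (hf.ne hqx)) hbq (hcl.isClique hq hx hqx)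
    have h3 := G.hereditary_isIndepSet.coverNumber_le_add (X := Y) (A := Y \ M) (B := M)
      (by rw [sdiff_union_self]; exact subset_union_left)
    exact h3.trans (Nat.add_le_add h2 h1)

/-- The tournament whose backward arcs along `f` are the edges of `G`. -/
def SimpleGraph.backArc (G : SimpleGraph V) (f : V → ℕ) (a b : V) : Prop :=
  (f a < f b ∧ ¬ G.Adj a b) ∨ (f b < f a ∧ G.Adj a b)

theorem SimpleGraph.isTournament_backArc (G : SimpleGraph V) {f : V → ℕ} (hf : f.Injective) :
    (⟨G.backArc f⟩ : Digraph V).IsTournament := by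
  refine ⟨fun v h => ?_, fun u v huv => ?_⟩
  · rcases h with h | h <;> exact lt_irrefl _ h.1
  · have := hf.ne huv
    have h2 : G.Adj v u ↔ G.Adj u v := G.adj_comm v u
    simp only [backArc, Xor, h2]
    rcases lt_or_gt_of_ne this with h3 | h3 <;> by_cases h : G.Adj u v <;>
      simp [h, h3, h3.not_gt]

/-- On an independent set every arc goes forward along `f`. -/
theorem SimpleGraph.dichi_backArc_le [Finite V] (G : SimpleGraph V) {f : V → ℕ}
    (hf : f.Injective) (X : Set V) : dichi (G.backArc f) X ≤ chiOn G X := by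
  have hr : IsTour (G.backArc f) := (G.isTournament_backArc hf).isTour
  have := G.hereditary_isIndepSet.coverNumber_le_mul (n := 1) (X := X) hr.hereditary
    fun Y _ hY => hr.hereditary.coverNumber_le_one ?_
  · rwa [mul_one] at this
  · have key : ∀ a ∈ Y, ∀ b ∈ Y, G.backArc f a b → f a < f b := by
      intro a ha b hb h
      rcases h with h | h
      · exact h.1
      · exact (hY ha hb h.2.ne h.2).elim
    intro a ha b hb c hc h1 h2 h3
    have := key a ha b hb h1
    have := key b hb c hc h2
    have := key c hc a ha h3
    omega

/-- On an acyclic set backward arcs compose, so adjacency is transitive along `f` there. -/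
theorem SimpleGraph.chiOn_le_mul_dichi_backArc [Finite V] (G : SimpleGraph V) {f : V → ℕ}
    (hf : f.Injective) {t : ℕ} (hG : G.CliqueFree (t + 1)) (X : Set V) :
    chiOn G X ≤ dichi (G.backArc f) X * t := by
  have hr : IsTour (G.backArc f) := (G.isTournament_backArc hf).isTour
  refine hr.hereditary.coverNumber_le_mul G.hereditary_isIndepSet fun Y _ hY => ?_
  refine G.chiOn_le_of_trans hf t Y (fun a ha b hb c hc h1 h2 h3 h4 => ?_) fun s _ => hG s
  have := hY.trans hr hc hb ha (Or.inr ⟨h2, h4.symm⟩) (Or.inr ⟨h1, h3.symm⟩)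
  rcases this with h | h
  · omega
  · exact h.2.symm

/-- If all neighbourhoods of `G` have small chromatic number, then a complete pair in the backward
arc tournament yields an anticomplete pair in `G`. -/
theorem SimpleGraph.hasAnticompletePair_of_backArc [Finite V] (G : SimpleGraph V) {f : V → ℕ}
    (hf : f.Injective) {c d : ℕ} (hc : 1 ≤ c) (hd : ∀ v, chiOn G (G.neighborSet v) < d)
    (h : HasPair (G.backArc f) (c + d + 1)) : G.HasAnticompletePair c := by
  classical
  obtain ⟨A, B, hA, hB, hAB⟩ := h
  have hP := G.hereditary_isIndepSet
  replace hA := hA.trans (G.dichi_backArc_le hf A)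
  replace hB := hB.trans (G.dichi_backArc_le hf B)
  have hex : ∃ i, c ≤ chiOn G {a | a ∈ A ∧ f a ≤ i} := by
    obtain ⟨N, hN⟩ := (Set.finite_range f).bddAbove
    refine ⟨N, le_trans (by omega) (hA.trans (hP.coverNumber_mono fun a ha => ?_))⟩
    exact ⟨ha, hN (mem_range_self a)⟩
  -- The cut point: leastness puts a vertex `a` of `A` at position `i`. Every vertex of `B` before
  -- `a` receives a backward arc from it, hence lies in its neighbourhood, and arcs from `A` up to
  -- `i` to `B` beyond `i` go forward, hence are non-edges.
  set i := Nat.find hex with hi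
  have hi1 : c ≤ chiOn G {a | a ∈ A ∧ f a ≤ i} := Nat.find_spec hex
  have ha0 : ∃ a ∈ A, f a = i := by
    by_contra! hne
    have h0 : i ≠ 0 := by
      intro h0
      obtain ⟨a, ha⟩ := hP.nonempty_of_coverNumber_pos (hc.trans hi1)
      have h1 := hne a ha.1
      have h2 := ha.2
      omega
    refine Nat.find_min hex (m := i - 1) (by omega) (hi1.trans (hP.coverNumber_mono ?_))
    rintro a ⟨ha, hai⟩
    have := hne a ha
    exact ⟨ha, by omega⟩
  obtain ⟨a, ha, hai⟩ := ha0
  have hne : ∀ x ∈ A, ∀ y ∈ B, f x ≠ f y := by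
    intro x hx y hy hxy
    rcases hAB x hx y hy with h | h <;> omega
  refine ⟨_, {b | b ∈ B ∧ i < f b}, hi1, ?_, ?_, ?_⟩
  · have h1 := hP.coverNumber_le_add (X := B) (A := G.neighborSet a) (B := {b | b ∈ B ∧ i < f b})
      fun b hb => by
        rcases lt_or_ge i (f b) with h | h
        · exact Or.inr ⟨hb, h⟩
        · rcases hAB a ha b hb with h' | h'
          · omega
          · exact Or.inl h'.2
    have h2 := hd a
    have h3 : chiOn G B ≤ chiOn G (G.neighborSet a) + chiOn G {b | b ∈ B ∧ i < f b} := h1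
    omega
  · rw [Set.disjoint_left]
    rintro x ⟨hx, _⟩ ⟨hx', _⟩
    exact hne x hx x hx' rfl
  · rintro x ⟨hx, hxi⟩ y ⟨hy, hyi⟩ hadj
    rcases hAB x hx y hy with h | h
    · exact h.2 hadj
    · omega

/-- Induction on the clique number bounds χ of neighbourhoods by `d`. If the back-arc tournament has
a `c`-cluster `S`, the vertices with no neighbour in `S` have χ below `c`, and the others lie in `S`
or in at most `s c` neighbourhoods. If it has none, the hypothesis bounds its dichromatic number.
The two summands of the bound match these cases. -/
theorem ClusterFreeConjecture.elZaharErdosConjecture {s : ℕ → ℕ}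
    (hs : ClusterFreeConjecture s) : ElZaharErdosConjecture := by
  classical
  rw [elZaharErdosConjecture_iff]
  obtain ⟨nss, hnss⟩ := hs
  suffices H : ∀ t c : ℕ, 1 ≤ c → ∃ d : ℕ, 1 ≤ d ∧ IsErdosBound t c d from
    fun t c _ hc => H t c hc
  intro t
  induction t with
  | zero =>
    refine fun c _ => ⟨1, le_rfl, fun V _ G hG _ => (hG ∅ ?_).elim⟩
    simp [SimpleGraph.isNClique_iff]
  | succ t ih =>
    intro c hc
    obtain ⟨d, hd1, hd⟩ := ih c hc
    refine ⟨(s c + s c * d + c) + nss c (c + d + 1) * t + 1, by omega, fun V _ G hG hbig => ?_⟩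
    by_contra hno
    have hP := G.hereditary_isIndepSet
    have hN : ∀ v, chiOn G (G.neighborSet v) < d :=
      fun v => hd.chiOn_lt hno (hG.induce_neighborSet v)
    obtain ⟨n, ⟨e⟩⟩ := Finite.exists_equiv_fin V
    set f : V → ℕ := fun v => e v
    have hf : f.Injective := fun x y h => e.injective (Fin.ext h)
    have hT := G.isTournament_backArc hf
    by_cases hcl : ∃ S : Set V, (⟨G.backArc f⟩ : Digraph V).IsCluster c (s c) S
    · obtain ⟨S, hfin, hcard, hS⟩ := hcl
      rw [hT.dichromaticNumber_induce, Nat.cast_le] at hS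
      replace hS := hS.trans (G.dichi_backArc_le hf S)
      lift S to Finset V using hfin
      rw [ncard_coe_finset] at hcard
      set R : Set V := {v | v ∉ S ∧ ∀ x ∈ S, ¬ G.Adj x v} with hR
      have hRc : chiOn G R < c := by
        by_contra! hRc
        refine hno ⟨S, R, hS, hRc, ?_, fun x hx v hv => hv.2 x hx⟩
        rw [Set.disjoint_left]
        exact fun x hx hxR => hxR.1 hx
      have h1 := hP.coverNumber_le_add (X := univ) (A := (S : Set V) ∪ ⋃ x ∈ S, G.neighborSet x)
        (B := R) fun v _ => by
          by_cases hv : v ∈ S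
          · exact Or.inl (Or.inl hv)
          · by_cases h : ∃ x ∈ S, G.Adj x v
            · obtain ⟨x, hx, hxv⟩ := h
              exact Or.inl (Or.inr (mem_biUnion hx hxv))
            · push Not at h
              exact Or.inr ⟨hv, h⟩
      have h2 := hP.coverNumber_union_le (S : Set V) (⋃ x ∈ S, G.neighborSet x)
      have h3 := hP.coverNumber_le_card S
      have h4 := hP.coverNumber_biUnion_le (n := d) S (fun x => G.neighborSet x)
        fun x _ => (hN x).le
      have h5 : S.card * d ≤ s c * d := Nat.mul_le_mul_right _ hcard
      simp only [chiOn] at *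
      omega
    · have hpair : ¬ (⟨G.backArc f⟩ : Digraph V).HasCompletePair (c + d + 1) := by
        rw [hT.hasCompletePair_iff]
        exact fun h => hno (G.hasAnticompletePair_of_backArc hf hc hN h)
      have h1 := hnss c (c + d + 1) hc (by omega) V _ hT hcl hpair
      rw [hT.dichromaticNumber_eq, Nat.cast_le] at h1
      have h2 := G.chiOn_le_mul_dichi_backArc hf hG univ
      have h3 := Nat.mul_le_mul_right t h1
      simp only [] at h3
      omega

end Graph

/-! ### Clusters and small dominating sets -/

/-- `X` contains at most `l` vertices inducing dichromatic number at least `t`. -/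
def HasCluster {V : Type*} (r : V → V → Prop) (t l : ℕ) (X : Set V) : Prop :=
  ∃ S : Finset V, (S : Set V) ⊆ X ∧ S.card ≤ l ∧ t ≤ dichi r S

/-- `X` contains at most `K` vertices dominating the others. -/
def IsDominated {V : Type*} (r : V → V → Prop) (K : ℕ) (X : Set V) : Prop :=
  ∃ D : Finset V, (D : Set V) ⊆ X ∧ D.card ≤ K ∧ ∀ x ∈ X, x ∈ D ∨ ∃ d ∈ D, r d x

section Domination

theorem HasCluster.mono {V : Type*} {r : V → V → Prop} {t l l' : ℕ} {X Y : Set V}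
    (h : HasCluster r t l X) (hXY : X ⊆ Y) (hl : l ≤ l') : HasCluster r t l' Y := by
  obtain ⟨S, h1, h2, h3⟩ := h
  exact ⟨S, h1.trans hXY, h2.trans hl, h3⟩

theorem hasCluster_swap {V : Type*} {r : V → V → Prop} {t l : ℕ} {X : Set V} :
    HasCluster (Function.swap r) t l X ↔ HasCluster r t l X := by
  simp only [HasCluster, dichi_swap]

/-- The inductive step towards large clusters in tournaments without small dominating sets. -/
theorem IsTour.hasCluster_succ_of_not_isDominated {V : Type*} [Finite V] {r : V → V → Prop}
    (hr : IsTour r) {k K l n : ℕ} (hn : n = K + l + 1)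
    (ih : ∀ Y : Set V, ¬ HasCluster r k l Y → IsDominated r K Y) {X : Set V}
    (hX : ¬ IsDominated r (k * n + 1 + K) X) :
    HasCluster r (k + 1) (l + 1 + (k * n + 1) + 2 ^ (k * n + 1) * l) X := by
  classical
  have hP := hr.hereditary
  have hex : ∃ s, IsDominated r s X :=
    ⟨_, X.toFinite.toFinset, by simp, le_rfl, fun x hx => Or.inl (by simpa using hx)⟩
  -- `D` is a smallest dominating set; exchanging part of it for a smaller set must destroy
  -- domination.
  obtain ⟨D, hDX, hDs, hDdom⟩ := Nat.find_spec hex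
  have hmin : ∀ s < D.card, ¬ IsDominated r s X :=
    fun s hs => Nat.find_min hex (hs.trans_le hDs)
  have hDbig : k * n + 1 + K < D.card := by
    by_contra! hle
    exact hX ⟨D, hDX, hle, hDdom⟩
  obtain ⟨W, hWD, hW⟩ := Finset.exists_subset_card_eq (s := D) (n := k * n + 1) (by omega)
  set Z : Set V := {x | x ∈ X ∧ ∀ w ∈ W, r x w} with hZ
  have hZdom : ¬ IsDominated r K Z := by
    rintro ⟨E, hEZ, hEc, hE⟩
    refine hX ⟨W ∪ E, ?_, (Finset.card_union_le _ _).trans (by omega), fun x hx => ?_⟩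
    · rw [Finset.coe_union]
      exact union_subset ((Finset.coe_subset.2 hWD).trans hDX) (hEZ.trans fun x hx => hx.1)
    · by_cases hxW : x ∈ W
      · exact Or.inl (Finset.mem_union_left _ hxW)
      by_cases hxZ : x ∈ Z
      · rcases hE x hxZ with h | ⟨d, hd, hdx⟩
        · exact Or.inl (Finset.mem_union_right _ h)
        · exact Or.inr ⟨d, Finset.mem_union_right _ hd, hdx⟩
      · simp only [hZ, mem_ofPred_eq, not_and, not_forall] at hxZ
        obtain ⟨w, hw, hxw⟩ := hxZ hx
        refine Or.inr ⟨w, Finset.mem_union_left _ hw, (hr.total ?_).resolve_right hxw⟩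
        rintro rfl
        exact hxW hw
  obtain ⟨A₀, hA₀Z, hA₀c, hA₀⟩ := not_imp_comm.1 (ih Z) hZdom
  obtain ⟨z, hz⟩ : Z.Nonempty := by
    rw [nonempty_iff_ne_empty]
    intro h
    exact hZdom ⟨∅, by simp, by simp, by simp [h]⟩
  -- Adding `z` keeps `A` nonempty even for `k = 0`; this keeps `W` away from the vertices pointing
  -- to all of `A`.
  set A := insert z A₀ with hAdef
  have hAZ : (A : Set V) ⊆ Z := by
    rw [hAdef, Finset.coe_insert, insert_subset_iff]
    exact ⟨hz, hA₀Z⟩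
  have hAc : A.card ≤ l + 1 := (Finset.card_insert_le _ _).trans (by omega)
  have hA : k ≤ dichi r A := hA₀.trans (hP.coverNumber_mono (by simp [hAdef]))
  have hC : ∀ W' : Finset V, ∃ C : Finset V, W' ∈ W.powersetCard (n + 1) →
      (C : Set V) ⊆ {x | x ∈ X ∧ (∃ w ∈ W', r w x) ∧ ∀ a ∈ A, r x a} ∧ C.card ≤ l ∧
        k ≤ dichi r C := by
    intro W'
    by_cases hW' : W' ∈ W.powersetCard (n + 1)
    swap
    · exact ⟨∅, fun h => (hW' h).elim⟩
    obtain ⟨hW'W, hW'c⟩ := Finset.mem_powersetCard.1 hW'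
    have hdom : ¬ IsDominated r K {x | x ∈ X ∧ (∃ w ∈ W', r w x) ∧ ∀ a ∈ A, r x a} := by
      rintro ⟨E, hEX, hEc, hE⟩
      -- Since `n = K + l + 1`, replacing the `n + 1` vertices of `W'` by `A` and `E` saves one
      -- vertex.
      have hcard : ((D \ W') ∪ A ∪ E).card ≤ D.card - (n + 1) + (l + 1) + K := by
        have h1 := Finset.card_union_le (D \ W' ∪ A) E
        have h2 := Finset.card_union_le (D \ W') A
        have h3 := Finset.card_sdiff_of_subset (hW'W.trans hWD)
        omega
      refine hmin ((D \ W') ∪ A ∪ E).card ?_ ⟨_, ?_, le_rfl, fun x hx => ?_⟩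
      · have := Finset.card_le_card hW'W
        have := Finset.card_le_card hWD
        omega
      · rw [Finset.coe_union, Finset.coe_union]
        refine union_subset (union_subset ?_ fun x hx => (hAZ hx).1) (hEX.trans fun x hx => hx.1)
        exact fun x hx => hDX (Finset.sdiff_subset hx)
      · simp only [Finset.mem_union, Finset.mem_sdiff]
        by_cases hxA : x ∈ A
        · exact Or.inl (Or.inl (Or.inr hxA))
        by_cases hax : ∃ a ∈ A, r a x
        · obtain ⟨a, ha, hax⟩ := hax
          exact Or.inr ⟨a, Or.inl (Or.inr ha), hax⟩
        push Not at hax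
        have hxA' : ∀ a ∈ A, r x a := fun a ha => by
          refine (hr.total ?_).resolve_right (hax a ha)
          rintro rfl
          exact hxA ha
        have hxW : x ∉ W := fun h => hax z (Finset.mem_insert_self _ _) (hz.2 x h)
        rcases hDdom x hx with h | ⟨d, hd, hdx⟩
        · exact Or.inl (Or.inl (Or.inl ⟨h, fun h' => hxW (hW'W h')⟩))
        · by_cases hdW : d ∈ W'
          · rcases hE x ⟨hx, ⟨d, hdW, hdx⟩, hxA'⟩ with h | ⟨e, he, hex⟩
            · exact Or.inl (Or.inr h)
            · exact Or.inr ⟨e, Or.inr he, hex⟩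
          · exact Or.inr ⟨d, Or.inl (Or.inl ⟨hd, hdW⟩), hdx⟩
    obtain ⟨C, h1, h2, h3⟩ := not_imp_comm.1 (ih _) hdom
    exact ⟨C, fun _ => ⟨h1, h2, h3⟩⟩
  choose C hC using hC
  set U := A ∪ W ∪ (W.powersetCard (n + 1)).biUnion C with hU
  refine ⟨U, ?_, ?_, ?_⟩
  · intro x hx
    simp only [hU, Finset.coe_union, mem_union, Finset.mem_coe, Finset.mem_biUnion] at hx
    rcases hx with (hx | hx) | ⟨W', hW', hx⟩
    · exact (hAZ hx).1
    · exact hDX (hWD hx)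
    · exact ((hC W' hW').1 hx).1
  · have h1 := Finset.card_union_le (A ∪ W) ((W.powersetCard (n + 1)).biUnion C)
    have h2 := Finset.card_union_le A W
    have h3 := Finset.card_biUnion_le_card_mul (W.powersetCard (n + 1)) C l
      fun W' hW' => (hC W' hW').2.1
    have h4 : (W.powersetCard (n + 1)).card ≤ 2 ^ (k * n + 1) := by
      rw [← hW, ← Finset.card_powerset]
      exact Finset.card_le_card fun W' hW' =>
        Finset.mem_powerset.2 (Finset.mem_powersetCard.1 hW').1
    have h5 := Nat.mul_le_mul_right l h4
    rw [← hU] at h1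
    omega
  · by_contra! hlt
    obtain ⟨f, hf⟩ := hP.exists_isCovering (U : Set V)
    have hfk : ∀ x ∈ U, f x < k := fun x hx => (hf.1 x hx).trans_le (Nat.lt_succ_iff.1 hlt)
    have hf' : IsCovering (TriangleFree r) (U : Set V) k f := ⟨hfk, hf.2⟩
    have hAU : A ⊆ U := fun x hx => by simp [hU, hx]
    have hWU : W ⊆ U := fun x hx => by simp [hU, hx]
    -- Some `n + 1` vertices `W'` of `W` share a colour `i`. Both `A` and `C W'` also contain colour
    -- `i`, which closes a triangle `w → c → a → w`.
    obtain ⟨i, hi, hbig⟩ := Finset.exists_lt_card_fiber_of_mul_lt_card_of_maps_to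
      (s := W) (t := Finset.range k) (f := f) (n := n)
      (fun x hx => Finset.mem_range.2 (hfk x (hWU hx))) (by rw [Finset.card_range, hW]; omega)
    obtain ⟨W', hW'sub, hW'c⟩ := Finset.exists_subset_card_eq hbig
    have hW'W : W' ⊆ W := hW'sub.trans (Finset.filter_subset _ _)
    have hW' : W' ∈ W.powersetCard (n + 1) := Finset.mem_powersetCard.2 ⟨hW'W, hW'c⟩
    have hCU : C W' ⊆ U := fun x hx =>
      Finset.mem_union_right _ (Finset.mem_biUnion.2 ⟨W', hW', hx⟩)
    have hik := Finset.mem_range.1 hi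
    obtain ⟨a, ha, hai⟩ := (hf'.mono hP (Finset.coe_subset.2 hAU)).exists_eq hP hA hik
    obtain ⟨c, hc, hci⟩ := (hf'.mono hP (Finset.coe_subset.2 hCU)).exists_eq hP
      (hC W' hW').2.2 hik
    obtain ⟨_, ⟨w, hw, hwc⟩, hca⟩ := (hC W' hW').1 hc
    refine hf.2 i w ⟨hWU (hW'W hw), (Finset.mem_filter.1 (hW'sub hw)).2⟩ c ⟨hCU hc, hci⟩
      a ⟨hAU ha, hai⟩ hwc (hca a ha) ((hAZ ha).2 w (hW'W hw))

/-- Sets of vertices without small clusters have small dominating sets. -/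
theorem exists_isDominated_of_not_hasCluster (k : ℕ) :
    ∃ K l : ℕ, ∀ (V : Type) [Finite V] (r : V → V → Prop), IsTour r →
      ∀ X : Set V, ¬ HasCluster r k l X → IsDominated r K X := by
  induction k with
  | zero => exact ⟨0, 0, fun V _ r _ X h => (h ⟨∅, by simp, by simp, by simp⟩).elim⟩
  | succ k ih =>
    obtain ⟨K, l, ih⟩ := ih
    refine ⟨k * (K + l + 1) + 1 + K,
      l + 1 + (k * (K + l + 1) + 1) + 2 ^ (k * (K + l + 1) + 1) * l, fun V _ r hr X h => ?_⟩
    by_contra hX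
    exact h (hr.hasCluster_succ_of_not_isDominated rfl (ih V r hr) hX)

/-- If every arc inside a set of `k + 1` vertices forms triangles with a `(k, l)`-cluster, then
there is a `(k + 1)`-cluster. -/
theorem IsTour.hasCluster_succ_of_arcNbhd {V : Type*} [Finite V] {r : V → V → Prop}
    (hr : IsTour r) {k l : ℕ} {Q : Finset V} (hQ : Q.card = k + 1)
    (h : ∀ u ∈ Q, ∀ v ∈ Q, r u v → HasCluster r k l (arcNbhd r u v)) :
    HasCluster r (k + 1) ((k + 1) + (k + 1) * (k + 1) * l) univ := by
  classical
  have hP := hr.hereditary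
  have hS : ∀ p : V × V, ∃ S : Finset V, S.card ≤ l ∧ (p.1 ∈ Q → p.2 ∈ Q → r p.1 p.2 →
      (S : Set V) ⊆ arcNbhd r p.1 p.2 ∧ k ≤ dichi r S) := by
    intro p
    by_cases hp : p.1 ∈ Q ∧ p.2 ∈ Q ∧ r p.1 p.2
    · obtain ⟨S, h1, h2, h3⟩ := h _ hp.1 _ hp.2.1 hp.2.2
      exact ⟨S, h2, fun _ _ _ => ⟨h1, h3⟩⟩
    · exact ⟨∅, by simp, fun h1 h2 h3 => (hp ⟨h1, h2, h3⟩).elim⟩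
  choose S hSc hS using hS
  refine ⟨Q ∪ (Q ×ˢ Q).biUnion S, subset_univ _, ?_, ?_⟩
  · have h1 := Finset.card_union_le Q ((Q ×ˢ Q).biUnion S)
    have h2 := Finset.card_biUnion_le_card_mul (Q ×ˢ Q) S l fun p _ => hSc p
    rw [Finset.card_product, hQ] at h2
    omega
  · set U := Q ∪ (Q ×ˢ Q).biUnion S with hU
    by_contra! hlt
    obtain ⟨f, hf⟩ := hP.exists_isCovering (U : Set V)
    have hfk : ∀ x ∈ U, f x < k := fun x hx => (hf.1 x hx).trans_le (Nat.lt_succ_iff.1 hlt)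
    have hf' : IsCovering (TriangleFree r) (U : Set V) k f := ⟨hfk, hf.2⟩
    have hQU : Q ⊆ U := Finset.subset_union_left
    -- Two of the `k + 1` vertices share a colour, and the cluster over their arc contains every
    -- colour.
    obtain ⟨u, hu, v, hv, huv, hfuv⟩ := Finset.exists_ne_map_eq_of_card_lt_of_maps_to
      (s := Q) (t := Finset.range k) (f := f) (by rw [Finset.card_range, hQ]; omega)
      (fun x hx => Finset.mem_coe.2 (Finset.mem_range.2 (hfk x (hQU hx))))
    wlog hr' : r u v generalizing u v
    · exact this v hv u hu huv.symm hfuv.symm ((hr.total huv).resolve_left hr')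
    obtain ⟨h1, h2⟩ := hS (u, v) hu hv hr'
    have hSU : S (u, v) ⊆ U := fun x hx => Finset.mem_union_right _
      (Finset.mem_biUnion.2 ⟨(u, v), Finset.mem_product.2 ⟨hu, hv⟩, hx⟩)
    obtain ⟨w, hw, hwi⟩ := (hf'.mono hP (Finset.coe_subset.2 hSU)).exists_eq hP h2
      (hfk u (hQU hu))
    obtain ⟨h3, h4⟩ := h1 hw
    exact hf.2 (f u) u ⟨hQU hu, rfl⟩ v ⟨hQU hv, hfuv.symm⟩ w ⟨hSU hw, hwi⟩ hr' h3 h4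

end Domination

/-! ### Sets with only light arcs inside or between them -/

section Local

/-- The distance from `v` as a level function on the vertices reachable from `v`. -/
theorem exists_level_function {V : Type*} (q : V → V → Prop) (v : V) :
    ∃ g : V → ℕ, (∀ a b, Relation.ReflTransGen q v a → q a b → g b ≤ g a + 1) ∧
      (∀ x, Relation.ReflTransGen q v x → g x = 0 → x = v) ∧
      ∀ x n, Relation.ReflTransGen q v x → g x = n + 1 →
        ∃ w, Relation.ReflTransGen q v w ∧ g w = n ∧ q w x := by
  classical
  -- `S n` holds the ends of walks with exactly `n` steps. The infimum below is 0 off the reachable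
  -- part, hence the reachability conditions.
  let S : ℕ → Set V := fun n => Nat.rec {v} (fun _ s => {x | ∃ w ∈ s, q w x}) n
  have hS : ∀ x, Relation.ReflTransGen q v x → {n | x ∈ S n}.Nonempty := by
    intro x hx
    induction hx with
    | refl => exact ⟨0, rfl⟩
    | tail _ h ih =>
      obtain ⟨n, hn⟩ := ih
      exact ⟨n + 1, _, hn, h⟩
  have hS' : ∀ n, ∀ x ∈ S n, Relation.ReflTransGen q v x := by
    intro n
    induction n with
    | zero =>
      intro x hx
      rw [show x = v from hx]
    | succ n ih =>
      rintro x ⟨w, hw, h⟩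
      exact (ih w hw).tail h
  have hstep : ∀ a b, Relation.ReflTransGen q v a → q a b →
      sInf {n | b ∈ S n} ≤ sInf {n | a ∈ S n} + 1 :=
    fun a b ha hab => Nat.sInf_le ⟨a, Nat.sInf_mem (hS a ha), hab⟩
  refine ⟨fun x => sInf {n | x ∈ S n}, hstep, fun x hx h0 => ?_, fun x n hx hn => ?_⟩
  · have h := Nat.sInf_mem (hS x hx)
    dsimp only at h0
    rw [h0] at h
    exact h
  · have h := Nat.sInf_mem (hS x hx)
    dsimp only at hn
    rw [hn] at h
    obtain ⟨w, hw, hwx⟩ := h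
    have h1 := hstep w x (hS' n w hw) hwx
    have h2 : sInf {k | w ∈ S k} ≤ n := Nat.sInf_le hw
    exact ⟨w, hS' n w hw, by dsimp only; omega, hwx⟩

/-- All arcs between `A` and `B` are in few triangles. -/
def IsLightBetween {V : Type*} (r : V → V → Prop) (m : ℕ) (A B : Set V) : Prop :=
  ∀ a ∈ A, ∀ b ∈ B, a ≠ b ∧ (r a b → dichi r (arcNbhd r a b) ≤ m) ∧
    (r b a → dichi r (arcNbhd r b a) ≤ m)

theorem IsLightBetween.mono {V : Type*} {r : V → V → Prop} {m : ℕ} {A A' B B' : Set V} (h : IsLightBetween r m A B)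
    (hA : A' ⊆ A) (hB : B' ⊆ B) : IsLightBetween r m A' B' :=
  fun a ha b hb => h a (hA ha) b (hB hb)

theorem IsLightBetween.swap {V : Type*} {r : V → V → Prop} {m : ℕ} {A B : Set V} (h : IsLightBetween r m A B) :
    IsLightBetween (Function.swap r) m A B := by
  intro a ha b hb
  have h1 (u v : V) : dichi (Function.swap r) (arcNbhd (Function.swap r) u v) =
      dichi r (arcNbhd r v u) := by
    rw [arcNbhd_swap, dichi_swap]
  rw [h1, h1]
  exact ⟨(h a ha b hb).1, (h a ha b hb).2.2, (h a ha b hb).2.1⟩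

variable {V : Type*} [Finite V] {r : V → V → Prop}

theorem IsTour.dichi_le_of_outNbhd (hr : IsTour r) {X : Set V} {K q : ℕ}
    (hD : IsDominated r K X) (h : ∀ a ∈ X, dichi r {x | x ∈ X ∧ r a x} ≤ q) :
    dichi r X ≤ K * (q + 1) := by
  obtain ⟨D, hDX, hDK, hD⟩ := hD
  have hP := hr.hereditary
  refine (hP.coverNumber_le_card_mul (n := q + 1) D (fun d => {x | x ∈ X ∧ r d x} ∪ {d})
    (fun x hx => ?_) fun d hd => ?_).trans (Nat.mul_le_mul_right _ hDK)
  · rcases hD x hx with h | ⟨d, hd, hdx⟩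
    · exact ⟨x, h, Or.inr rfl⟩
    · exact ⟨d, hd, Or.inl ⟨hx, hdx⟩⟩
  · exact (hP.coverNumber_union_le _ _).trans
      (Nat.add_le_add (h d (hDX hd)) (hP.coverNumber_le_one (hP.subsingleton
        subsingleton_singleton)))

/-- If all arcs inside `X` are in few triangles, then the in-neighbours of a vertex of `X` that
are reachable from it inside `X` have bounded dichromatic number. -/
theorem IsTour.dichi_inNbhd_reachable_le (hr : IsTour r) {X : Set V} {K m : ℕ}
    (hD : ∀ Y, IsDominated r K Y)
    (hl : ∀ u ∈ X, ∀ v ∈ X, r u v → dichi r (arcNbhd r u v) ≤ m) {v : V} (hv : v ∈ X) :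
    dichi r {x | x ∈ X ∧ r x v ∧ Relation.ReflTransGen (fun a b => r a b ∧ b ∈ X) v x} ≤
      2 * (K * (2 * m + 1)) := by
  have hP := hr.hereditary
  obtain ⟨g, hg1, hg0, hgs⟩ := exists_level_function (fun a b => r a b ∧ b ∈ X) v
  have hreachX : ∀ w, Relation.ReflTransGen (fun a b => r a b ∧ b ∈ X) v w → w ∈ X := by
    intro w hw
    rcases Relation.ReflTransGen.cases_tail hw with h | ⟨_, _, h⟩
    · exact h ▸ hv
    · exact h.2
  refine hr.dichi_le_of_levels g (fun a ha b hb hab => hg1 a b ha.2.2 ⟨hab, hb.1⟩) fun i => ?_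
  -- Level 0 is `v` and level 1 lies in its out-neighbourhood, so neither meets its
  -- in-neighbourhood. At a deeper level let `w' → w → d` end a shortest walk to a dominating vertex
  -- `d`. An out-neighbour `x` of `d` at the same level satisfies `x → w'`, so it forms a triangle
  -- with `w d` or with `w' w`.
  rcases i with _ | _ | j
  · refine (hP.coverNumber_mono (Y := ∅) ?_).trans (by rw [hP.coverNumber_empty]; omega)
    rintro x ⟨⟨_, hxv, hx⟩, h0⟩
    rw [hg0 x hx h0] at hxv
    exact hr.irrefl v hxv
  · refine (hP.coverNumber_mono (Y := ∅) ?_).trans (by rw [hP.coverNumber_empty]; omega)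
    rintro x ⟨⟨_, hxv, hx⟩, h1⟩
    obtain ⟨w, hw, hw0, hwx⟩ := hgs x 0 hx h1
    rw [hg0 w hw hw0] at hwx
    exact hr.asymm hxv hwx.1
  · set F : Set V := {x | x ∈ {x | x ∈ X ∧ r x v ∧
      Relation.ReflTransGen (fun a b => r a b ∧ b ∈ X) v x} ∧ g x = j + 1 + 1} with hF
    obtain ⟨D, hDF, hDK, hD⟩ := hD F
    have hpar : ∀ d, ∃ S : Set V, dichi r S ≤ 2 * m + 1 ∧
        (d ∈ D → ∀ x ∈ F, x = d ∨ r d x → x ∈ S) := by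
      intro d
      by_cases hd : d ∈ D
      swap
      · exact ⟨∅, hP.coverNumber_empty.le.trans (Nat.zero_le _), fun h => (hd h).elim⟩
      obtain ⟨⟨hdX, _, hdr⟩, hdj⟩ := hDF hd
      obtain ⟨w, hw, hwj, hwd⟩ := hgs d _ hdr hdj
      obtain ⟨w', hw', hw'j, hw'w⟩ := hgs w _ hw hwj
      refine ⟨(arcNbhd r w d ∪ arcNbhd r w' w) ∪ {d}, ?_, fun _ x hx hdx => ?_⟩
      · have h1 := hP.coverNumber_union_le (arcNbhd r w d ∪ arcNbhd r w' w) {d}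
        have h2 := hP.coverNumber_union_le (arcNbhd r w d) (arcNbhd r w' w)
        have h3 := hP.coverNumber_le_one (hP.subsingleton (subsingleton_singleton (a := d)))
        have h4 := hl w (hreachX w hw) d hdX hwd.1
        have h5 := hl w' (hreachX w' hw') w (hreachX w hw) hw'w.1
        simp only [dichi] at *
        omega
      · obtain ⟨⟨hxX, _, hxr⟩, hxj⟩ := hx
        rcases hdx with rfl | hdx
        · exact Or.inr rfl
        have hne : x ≠ w := by
          rintro rfl
          omega
        have hne' : x ≠ w' := by
          rintro rfl
          omega
        rcases hr.total hne with hxw | hwx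
        · exact Or.inl (Or.inl ⟨hdx, hxw⟩)
        · refine Or.inl (Or.inr ⟨hwx, (hr.total hne').resolve_right fun h => ?_⟩)
          have := hg1 w' x hw' ⟨h, hxX⟩
          omega
    choose S hS hDS using hpar
    refine (hP.coverNumber_le_card_mul D S (fun x hx => ?_) fun d _ => hS d).trans
      (Nat.mul_le_mul_right _ hDK)
    rcases hD x hx with h | ⟨d, hd, hdx⟩
    · exact ⟨x, h, hDS x h x hx (Or.inl rfl)⟩
    · exact ⟨d, hd, hDS d hd x hx (Or.inr hdx)⟩

/-- If all arcs inside `X` are in few triangles, then `X` has bounded dichromatic number. -/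
theorem IsTour.dichi_le_of_arcNbhd (hr : IsTour r) {X : Set V} {K m : ℕ}
    (hD : ∀ Y, IsDominated r K Y) (hD' : ∀ Y, IsDominated (Function.swap r) K Y)
    (hl : ∀ u ∈ X, ∀ v ∈ X, r u v → dichi r (arcNbhd r u v) ≤ m) :
    dichi r X ≤ K * (2 * (K * (2 * m + 1)) + 1) := by
  have hP := hr.hereditary
  set q : V → V → Prop := fun a b => r a b ∧ b ∈ X with hq
  refine hr.dichi_le_of_fibers
    -- The fibres on `X` are its strong components. Each triangle lies in one, and there all
    -- in-neighbours of `d` are reachable from `d`.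
    (fun x => {y | Relation.ReflTransGen q x y ∧ Relation.ReflTransGen q y x})
    (fun a ha b hb c hc hab hbc hca => ?_) fun C => ?_
  · have h1 : Relation.ReflTransGen q a b := Relation.ReflTransGen.single ⟨hab, hb⟩
    have h2 : Relation.ReflTransGen q b a :=
      (Relation.ReflTransGen.single ⟨hbc, hc⟩).tail ⟨hca, ha⟩
    ext y
    exact ⟨fun h => ⟨h2.trans h.1, h.2.trans h1⟩, fun h => ⟨h1.trans h.1, h.2.trans h2⟩⟩
  · rw [← dichi_swap]
    refine hr.swap.dichi_le_of_outNbhd (hD' _) fun d hd => ?_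
    rw [dichi_swap]
    refine (hP.coverNumber_mono ?_).trans (hr.dichi_inNbhd_reachable_le hD hl hd.1)
    rintro x ⟨⟨hx, hxC⟩, hxd⟩
    have : x ∈ {y | Relation.ReflTransGen q d y ∧ Relation.ReflTransGen q y d} := by
      rw [hd.2, ← hxC]
      exact ⟨Relation.ReflTransGen.refl, Relation.ReflTransGen.refl⟩
    exact ⟨hx, hxd, this.1⟩

/-- A nearly complete pair with light arcs yields a complete pair. -/
theorem IsTour.hasPair_of_inNbhd_le (hr : IsTour r) {K m q c : ℕ} {A B : Set V}
    (hD' : ∀ Y, IsDominated (Function.swap r) K Y) (hAB : IsLightBetween r m A B)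
    (hq : ∀ a ∈ A, dichi r {b | b ∈ B ∧ r b a} ≤ q) (hA : c ≤ dichi r A)
    (hB : c + K * (q + m + 1) ≤ dichi r B) : HasPair r c := by
  have hP := hr.hereditary
  -- An arc from `b` in `B` to `a` in `A` forces every in-neighbour of `b` in `B` to point to `a` or
  -- to form a triangle with `b a`. So backward arcs start only in `B₀`.
  set B₀ : Set V := {b | b ∈ B ∧ dichi r {x | x ∈ B ∧ r x b} ≤ q + m} with hB₀
  have h0 : dichi r B₀ ≤ K * (q + m + 1) := by
    rw [← dichi_swap]
    refine hr.swap.dichi_le_of_outNbhd (hD' _) fun d hd => ?_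
    rw [dichi_swap]
    exact (hP.coverNumber_mono (ofPred_subset_ofPred.2 fun x hx => ⟨hx.1.1, hx.2⟩)).trans hd.2
  refine ⟨A, B \ B₀, hA, ?_, fun a ha b hb => ?_⟩
  · have := hP.coverNumber_le_add (X := B) (A := B \ B₀) (B := B₀)
      (by rw [sdiff_union_self]; exact subset_union_left)
    simp only [dichi] at *
    omega
  · obtain ⟨hne, _, h2⟩ := hAB a ha b hb.1
    refine (hr.total hne).resolve_right fun hba => hb.2 ⟨hb.1, ?_⟩
    refine (hP.coverNumber_le_add (A := {b | b ∈ B ∧ r b a}) (B := arcNbhd r b a) ?_).trans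
      (Nat.add_le_add (hq a ha) (h2 hba))
    rintro x ⟨hx, hxb⟩
    rcases hr.total (hAB a ha x hx).1 with h | h
    · exact Or.inr ⟨h, hxb⟩
    · exact Or.inl ⟨hx, h⟩

theorem IsTour.hasPair_of_outNbhd_le (hr : IsTour r) {K m q c : ℕ} {A B : Set V}
    (hD : ∀ Y, IsDominated r K Y) (hAB : IsLightBetween r m A B)
    (hq : ∀ a ∈ A, dichi r {b | b ∈ B ∧ r a b} ≤ q) (hA : c ≤ dichi r A)
    (hB : c + K * (q + m + 1) ≤ dichi r B) : HasPair r c := by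
  refine HasPair.of_swap (hr.swap.hasPair_of_inNbhd_le hD hAB.swap (q := q) (fun a ha => ?_) ?_ ?_)
  · rw [dichi_swap]
    exact hq a ha
  · rwa [dichi_swap]
  · rwa [dichi_swap]

/-- Two sets with only light arcs between them yield a complete pair. -/
theorem IsTour.hasPair_of_isLightBetween (hr : IsTour r) {K m c : ℕ} {A B : Set V}
    (hD : ∀ Y, IsDominated r K Y) (hD' : ∀ Y, IsDominated (Function.swap r) K Y)
    (hAB : IsLightBetween r m A B) (hA : 2 * c ≤ dichi r A)
    (hB : c + K * (c + K * (2 * m + m + 1) + m + 1) ≤ dichi r B) : HasPair r c := by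
  have hP := hr.hereditary
  by_contra hno
  have key : ∀ (q : ℕ) (B₁ B₂ : Set V), B₁ ⊆ B → B₂ ⊆ B → c + K * (q + m + 1) ≤ dichi r B₁ →
      c + K * (q + m + 1) ≤ dichi r B₂ → ∃ u ∈ A, q < dichi r {b | b ∈ B₁ ∧ r u b} ∧
        q < dichi r {b | b ∈ B₂ ∧ r b u} := by
    intro q B₁ B₂ h1 h2 hB₁ hB₂
    by_contra! hne
    set A₁ : Set V := {a | a ∈ A ∧ dichi r {b | b ∈ B₁ ∧ r a b} ≤ q}
    set A₂ : Set V := {a | a ∈ A ∧ dichi r {b | b ∈ B₂ ∧ r b a} ≤ q}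
    have e1 : dichi r A₁ < c := by
      by_contra! h
      exact hno (hr.hasPair_of_outNbhd_le hD (hAB.mono (fun a ha => ha.1) h1)
        (fun a ha => ha.2) h hB₁)
    have e2 : dichi r A₂ < c := by
      by_contra! h
      exact hno (hr.hasPair_of_inNbhd_le hD' (hAB.mono (fun a ha => ha.1) h2)
        (fun a ha => ha.2) h hB₂)
    have e3 := hP.coverNumber_le_add (X := A) (A := A₁) (B := A₂) fun a ha => by
      rcases le_or_gt (dichi r {b | b ∈ B₁ ∧ r a b}) q with h | h
      · exact Or.inl ⟨ha, h⟩
      · exact Or.inr ⟨ha, hne a ha h⟩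
    simp only [dichi] at *
    omega
  -- First `u` splits `B` into two large sides; then `w` has large out-part in the in-side of `u`
  -- and large in-part in its out-side. For `w → v → u`, every `x` with `u → x → w` forms a triangle
  -- with `w v` or `v u`, so that in-part is at most `2 * m`.
  obtain ⟨u, hu, hu1, hu2⟩ := key (c + K * (2 * m + m + 1)) B B subset_rfl subset_rfl hB hB
  obtain ⟨w, hw, hw1, hw2⟩ := key (2 * m) {b | b ∈ B ∧ r b u} {b | b ∈ B ∧ r u b}
    (fun b hb => hb.1) (fun b hb => hb.1) hu2.le hu1.le
  obtain ⟨v, ⟨hvB, hvu⟩, hwv⟩ := hP.nonempty_of_coverNumber_pos ((Nat.zero_le _).trans_lt hw1)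
  refine hw2.not_ge ?_
  have h1 := (hAB w hw v hvB).2.1 hwv
  have h2 := (hAB u hu v hvB).2.2 hvu
  refine (hP.coverNumber_le_add (A := arcNbhd r w v) (B := arcNbhd r v u) ?_).trans
    ((Nat.add_le_add h1 h2).trans (by omega))
  rintro x ⟨⟨hxB, hux⟩, hxw⟩
  have hne : v ≠ x := by
    rintro rfl
    exact hr.asymm hvu hux
  rcases hr.total hne with h | h
  · exact Or.inl ⟨h, hxw⟩
  · exact Or.inr ⟨hux, h⟩

end Local

/-! ### The graph of heavy arcs -/

section Heavy

/-- If every edge of `G` spans an interval of small chromatic number, then `G` has bounded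
chromatic number. -/
theorem SimpleGraph.chiOn_le_of_intervals {V : Type*} [Finite V] (G : SimpleGraph V) {f : V → ℕ}
    {Y : Set V} (hf : InjOn f Y) {n : ℕ} (hn : 1 ≤ n)
    (h : ∀ x ∈ Y, ∀ y ∈ Y, G.Adj x y → f x < f y →
      chiOn G {z | z ∈ Y ∧ f x ≤ f z ∧ f z ≤ f y} < n) : chiOn G Y ≤ 2 * n := by
  classical
  have hP := G.hereditary_isIndepSet
  -- Greedy cutting of the order into blocks: a new block starts once the current one reaches χ at
  -- least `n`, and `S k` is the set of positions from block `k` on.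
  let S : ℕ → Set ℕ := fun k => Nat.rec univ
    (fun _ s => {j | ∃ p ∈ s, n ≤ chiOn G {z | z ∈ Y ∧ p ≤ f z ∧ f z < j}}) k
  have hS : ∀ k i j, i ∈ S (k + 1) → i ≤ j → j ∈ S (k + 1) := by
    rintro k i j ⟨p, hp, hpi⟩ hij
    exact ⟨p, hp, hpi.trans (hP.coverNumber_mono (ofPred_subset_ofPred.2
      fun z hz => ⟨hz.1, hz.2.1, hz.2.2.trans_le hij⟩))⟩
  have hS' : ∀ k i j, i ∈ S k → i ≤ j → j ∈ S k := by
    rintro (_ | k) i j hi hij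
    · trivial
    · exact hS k i j hi hij
  have hlt : ∀ p j, n ≤ chiOn G {z | z ∈ Y ∧ p ≤ f z ∧ f z < j} → p < j := by
    intro p j hj
    obtain ⟨z, hz⟩ := hP.nonempty_of_coverNumber_pos (hn.trans hj)
    exact hz.2.1.trans_lt hz.2.2
  have hanti : ∀ k i, i ∈ S (k + 1) → i ∈ S k := by
    rintro k i ⟨p, hp, hpi⟩
    exact hS' k p i hp (hlt p i hpi).le
  have hanti' : Antitone S := antitone_nat_of_succ_le hanti
  have hle : ∀ k i, i ∈ S k → k ≤ i := by
    intro k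
    induction k with
    | zero => exact fun i _ => Nat.zero_le i
    | succ k ih =>
      rintro i ⟨p, hp, hpi⟩
      exact (Nat.succ_le_succ (ih p hp)).trans (hlt p i hpi)
  have hex : ∀ y, ∃ k, f y ∉ S (k + 1) := fun y => ⟨f y, fun hy => by
    have := hle (f y + 1) (f y) hy
    omega⟩
  set g : V → ℕ := fun y => Nat.find (hex y) with hg
  have hg1 : ∀ y, f y ∉ S (g y + 1) := fun y => Nat.find_spec (hex y)
  have hg2 : ∀ y, f y ∈ S (g y) := by
    intro y
    rcases hk : g y with _ | k
    · trivial
    · exact not_not.1 (Nat.find_min (hex y) (m := k) (by change k < g y; omega))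
  refine hP.coverNumber_le_of_levels g (fun Z hZ hp hi => ?_) fun k => ?_
  · have key : ∀ x ∈ Z, ∀ y ∈ Z, f x < f y → ¬ G.Adj x y := by
      intro x hx y hy hxy hadj
      have h1 : g x ≤ g y := by
        by_contra! hlt
        exact hg1 y (hanti' (Nat.succ_le_of_lt hlt) (hS' _ _ _ (hg2 x) hxy.le))
      -- An edge skipping a whole block would span an interval of χ at least `n`. So edges join
      -- equal or consecutive blocks, and parity removes the latter.
      have h2 : g y ≤ g x + 1 := by
        by_contra! hgt
        obtain ⟨p, hp, hpy⟩ := hanti' (Nat.succ_le_of_lt hgt) (hg2 y)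
        have h3 : f x < p := by
          by_contra! hpx
          exact hg1 x (hS' (g x + 1) p (f x) hp hpx)
        refine (h x (hZ hx) y (hZ hy) hadj hxy).not_ge (hpy.trans (hP.coverNumber_mono ?_))
        exact ofPred_subset_ofPred.2 fun z hz => ⟨hz.1, h3.le.trans hz.2.1, hz.2.2.le⟩
      have h3 := hp x hx y hy
      have h4 : g y = g x := by omega
      exact hi (g x) ⟨hx, rfl⟩ ⟨hy, h4⟩ hadj.ne hadj
    intro x hx y hy hne hadj
    rcases lt_or_gt_of_ne (hf.ne (hZ hx) (hZ hy) hne) with h1 | h1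
    · exact key x hx y hy h1 hadj
    · exact key y hy x hx h1 hadj.symm
  · set F : Set V := {x | x ∈ Y ∧ g x = k} with hF
    rcases F.eq_empty_or_nonempty with h0 | hne
    · rw [h0]
      exact hP.coverNumber_empty.le.trans (Nat.zero_le _)
    obtain ⟨p, hpF, hp⟩ := F.toFinite.exists_minimalFor f F hne
    obtain ⟨q, hqF, hq⟩ := F.toFinite.exists_maximalFor f F hne
    have hp' : ∀ x ∈ F, f p ≤ f x := fun x hx => by
      rcases le_total (f p) (f x) with h | h
      · exact h
      · exact hp hx h
    have hq' : ∀ x ∈ F, f x ≤ f q := fun x hx => by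
      rcases le_total (f x) (f q) with h | h
      · exact h
      · exact hq hx h
    have h1 : chiOn G {z | z ∈ Y ∧ f p ≤ f z ∧ f z < f q} < n := by
      by_contra! hbig
      refine hg1 q ?_
      rw [hqF.2, ← hpF.2]
      exact ⟨f p, hg2 p, hbig⟩
    have h2 := hP.coverNumber_le_add (X := F) (A := {z | z ∈ Y ∧ f p ≤ f z ∧ f z < f q})
      (B := {q}) fun x hx => by
        rcases (hq' x hx).lt_or_eq with h | h
        · exact Or.inl ⟨hx.1, hp' x hx, h⟩
        · exact Or.inr (hf hx.1 hqF.1 h)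
    have h3 := hP.coverNumber_le_one (hP.subsingleton (subsingleton_singleton (a := q)))
    simp only [chiOn] at *
    omega

variable {V : Type*} {r : V → V → Prop}

/-- The graph of the arcs whose triangles have dichromatic number more than `m`. -/
def heavyGraph (r : V → V → Prop) (m : ℕ) : SimpleGraph V :=
  SimpleGraph.fromRel fun u v => r u v ∧ m < dichi r (arcNbhd r u v)

theorem IsTour.heavyGraph_adj (hr : IsTour r) {m : ℕ} {u v : V} (h : r u v) :
    (heavyGraph r m).Adj u v ↔ m < dichi r (arcNbhd r u v) := by
  rw [heavyGraph, SimpleGraph.fromRel_adj]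
  constructor
  · rintro ⟨_, h1 | h1⟩
    · exact h1.2
    · exact (hr.asymm h h1.1).elim
  · exact fun h1 => ⟨hr.ne h, Or.inl ⟨h, h1⟩⟩

theorem heavyGraph_anti {m n : ℕ} (h : m ≤ n) : heavyGraph r n ≤ heavyGraph r m := by
  intro u v huv
  rw [heavyGraph, SimpleGraph.fromRel_adj] at huv ⊢
  exact ⟨huv.1, huv.2.imp (fun h1 => ⟨h1.1, h.trans_lt h1.2⟩) fun h1 => ⟨h1.1, h.trans_lt h1.2⟩⟩

/-- The bound on the chromatic number of the heavy graph on an acyclic set. -/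
def heavyBound : ℕ → ℕ
  | 0 => 0
  | t + 1 => 2 * (2 * heavyBound t + 3)

/-- On acyclic sets, the chromatic number of the heavy graph is bounded in terms of its clique
number, with the threshold for being heavy doubled. -/
theorem IsTour.chiOn_heavyGraph_le [Finite V] (hr : IsTour r) (m t : ℕ) (Y : Set V)
    (hY : TriangleFree r Y)
    (hfree : ∀ s : Finset V, (s : Set V) ⊆ Y → ¬ (heavyGraph r m).IsNClique t s) :
    chiOn (heavyGraph r (2 * m)) Y ≤ heavyBound t := by
  classical
  induction t generalizing Y with
  | zero => exact (hfree ∅ (by simp) (by simp [SimpleGraph.isNClique_iff])).elim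
  | succ t ih =>
    have hG := (heavyGraph r (2 * m)).hereditary_isIndepSet
    have hP := hr.hereditary
    have hN : ∀ y ∈ Y, chiOn (heavyGraph r (2 * m)) {z | z ∈ Y ∧ (heavyGraph r m).Adj y z} ≤
        heavyBound t := by
      intro y hy
      refine ih _ (hP.mono (fun z hz => hz.1) hY) fun s hs hcl => ?_
      refine hfree (insert y s) ?_ (hcl.insert fun z hz => (hs hz).2)
      rw [Finset.coe_insert, insert_subset_iff]
      exact ⟨hy, fun z hz => (hs hz).1⟩
    -- The in-degree inside `Y` recovers the transitive order on `Y`. If `z` lies between `x` and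
    -- `y`, each triangle on `x y` yields one on `x z` or `z y`. So an arc heavy at `2 * m` has its
    -- interval inside the two `m`-heavy neighbourhoods and `{x, y}`.
    set f : V → ℕ := fun y => {z | z ∈ Y ∧ r z y}.ncard with hfdef
    have hlt : ∀ x ∈ Y, ∀ y ∈ Y, r x y → f x < f y := by
      intro x hx y hy hxy
      refine ncard_lt_ncard ((ssubset_iff_of_subset ?_).2 ⟨x, ⟨hx, hxy⟩, ?_⟩) (toFinite _)
      · exact fun z hz => ⟨hz.1, hY.trans hr hz.1 hx hy hz.2 hxy⟩
      · exact fun h => hr.irrefl _ h.2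
    have hrlt : ∀ x ∈ Y, ∀ y ∈ Y, f x < f y → r x y := by
      intro x hx y hy hxy
      refine (hr.total ?_).resolve_right fun h => ?_
      · rintro rfl
        exact hxy.false
      · exact (hlt y hy x hx h).asymm hxy
    have hinj : InjOn f Y := by
      intro x hx y hy hxy
      by_contra hne
      rcases hr.total hne with h | h
      · exact (hlt x hx y hy h).ne hxy
      · exact (hlt y hy x hx h).ne hxy.symm
    refine SimpleGraph.chiOn_le_of_intervals _ hinj (by omega) fun x hx y hy hadj hxy => ?_
    have hrxy := hrlt x hx y hy hxy
    rw [hr.heavyGraph_adj hrxy] at hadj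
    set A : Set V := {z | z ∈ Y ∧ (heavyGraph r m).Adj x z} with hA
    set B : Set V := {z | z ∈ Y ∧ (heavyGraph r m).Adj y z} with hB
    have h1 := hG.coverNumber_le_add (X := {z | z ∈ Y ∧ f x ≤ f z ∧ f z ≤ f y})
      (A := A ∪ B) (B := {x} ∪ {y}) fun z hz => by
        by_cases hzx : z = x
        · exact Or.inr (Or.inl hzx)
        by_cases hzy : z = y
        · exact Or.inr (Or.inr hzy)
        left
        have hxz : r x z := hrlt x hx z hz.1
          (lt_of_le_of_ne hz.2.1 fun h => hzx (hinj hz.1 hx h.symm))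
        have hzy : r z y := hrlt z hz.1 y hy
          (lt_of_le_of_ne hz.2.2 fun h => hzy (hinj hz.1 hy h))
        by_contra hno
        have hnx : ¬ (heavyGraph r m).Adj x z := fun h => hno (Or.inl ⟨hz.1, h⟩)
        have hny : ¬ (heavyGraph r m).Adj z y := fun h => hno (Or.inr ⟨hz.1, h.symm⟩)
        rw [hr.heavyGraph_adj hxz, not_lt] at hnx
        rw [hr.heavyGraph_adj hzy, not_lt] at hny
        have h2 := hP.coverNumber_le_add (X := arcNbhd r x y) (A := arcNbhd r x z)
          (B := arcNbhd r z y) fun w hw => by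
            have hne : z ≠ w := by
              rintro rfl
              exact hr.asymm hzy hw.1
            rcases hr.total hne with h | h
            · exact Or.inl ⟨h, hw.2⟩
            · exact Or.inr ⟨hw.1, h⟩
        simp only [dichi] at *
        omega
    have h2 := hG.coverNumber_union_le A B
    have h3 := hG.coverNumber_union_le {x} {y}
    have h4 := hG.coverNumber_le_one (hG.subsingleton (subsingleton_singleton (a := x)))
    have h5 := hG.coverNumber_le_one (hG.subsingleton (subsingleton_singleton (a := y)))
    have h6 : chiOn (heavyGraph r (2 * m)) A ≤ heavyBound t := hN x hx
    have h7 : chiOn (heavyGraph r (2 * m)) B ≤ heavyBound t := hN y hy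
    simp only [chiOn] at *
    omega

end Heavy

/-! ### From the El-Zahar–Erdős conjecture to tournaments -/

/-- Tournaments without `(t, l)`-clusters and complete pairs have bounded dichromatic number. -/
theorem exists_dichi_le_of_not_hasCluster (hEE : ElZaharErdosConjecture) (c t : ℕ) :
    ∃ l d : ℕ, ∀ (V : Type) [Finite V] (r : V → V → Prop), IsTour r →
      ¬ HasCluster r t l univ → ¬ HasPair r c → dichi r univ ≤ d := by
  rw [elZaharErdosConjecture_iff] at hEE
  induction t with
  | zero => exact ⟨0, 0, fun V _ r _ h => (h ⟨∅, by simp, by simp, by simp⟩).elim⟩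
  | succ t ih =>
    obtain ⟨l, m, ih⟩ := ih
    obtain ⟨K, l', hdom⟩ := exists_isDominated_of_not_hasCluster (t + 1)
    -- `M` meets both size requirements of `IsTour.hasPair_of_isLightBetween`, with light meaning at
    -- most `2 * m`.
    obtain ⟨M, hM⟩ : ∃ M, M = c + K * (c + K * (2 * (2 * m) + 2 * m + 1) + 2 * m + 1) + 2 * c :=
      ⟨_, rfl⟩
    obtain ⟨d, _, hd⟩ := hEE (t + 1) (M * heavyBound (t + 1) + 1) (by omega) (by omega)
    refine ⟨max l' ((t + 1) + (t + 1) * (t + 1) * l),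
      d * (K * (2 * (K * (2 * (2 * m) + 1)) + 1)), fun V _ r hr hcl hpair => ?_⟩
    have hP := hr.hereditary
    have hG := (heavyGraph r (2 * m)).hereditary_isIndepSet
    have hdom1 : ∀ Y, IsDominated r K Y := fun Y => hdom V r hr Y fun h =>
      hcl (h.mono (subset_univ _) (le_max_left _ _))
    have hdom2 : ∀ Y, IsDominated (Function.swap r) K Y := fun Y => hdom V _ hr.swap Y fun h =>
      hcl ((hasCluster_swap.1 h).mono (subset_univ _) (le_max_left _ _))
    have hsub : ∀ X : Set V, m < dichi r X → HasCluster r t l X := by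
      intro X hX
      by_contra hno
      have hr' : IsTour (fun a b : X => r a b) :=
        ⟨fun u v h => hr.asymm h, fun u v h => hr.total fun h' => h (Subtype.ext h')⟩
      have h1 := ih X (fun a b : X => r a b) hr' ?_ ?_
      · rw [dichi_subtype hr, image_univ, Subtype.range_coe] at h1
        omega
      · rintro ⟨S, _, hSl, hSt⟩
        rw [dichi_subtype hr] at hSt
        refine hno ⟨S.map (Function.Embedding.subtype _), ?_, by simpa using hSl, by simpa using hSt⟩
        rintro _ hx
        obtain ⟨y, _, rfl⟩ := Finset.mem_map.1 (Finset.mem_coe.1 hx)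
        exact y.2
      · rintro ⟨A, B, hA, hB, hAB⟩
        rw [dichi_subtype hr] at hA hB
        refine hpair ⟨_, _, hA, hB, ?_⟩
        rintro _ ⟨a, ha, rfl⟩ _ ⟨b, hb, rfl⟩
        exact hAB a ha b hb
    -- Every `m`-heavy arc carries a `t`-cluster by the induction hypothesis, so a clique of size `t
    -- + 1` would give a `(t + 1)`-cluster.
    have hfree : (heavyGraph r m).CliqueFree (t + 1) := by
      intro Q hQ
      refine hcl ((hr.hasCluster_succ_of_arcNbhd (k := t) (l := l) hQ.card_eq
        fun u hu v hv huv => hsub _ ?_).mono subset_rfl (le_max_right _ _))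
      exact (hr.heavyGraph_adj huv).1 (hQ.isClique hu hv (hr.ne huv))
    have hchi : chiOn (heavyGraph r (2 * m)) univ < d := by
      by_contra! hbig
      obtain ⟨A, B, hA, hB, hdisj, hAB⟩ := hd V (heavyGraph r (2 * m))
        (hfree.anti (heavyGraph_anti (by omega))) hbig
      have hbd : ∀ X : Set V, M * heavyBound (t + 1) + 1 ≤ chiOn (heavyGraph r (2 * m)) X →
          M ≤ dichi r X := by
        intro X hX
        have h1 := hP.coverNumber_le_mul (X := X) hG
          fun Y _ hY => hr.chiOn_heavyGraph_le m (t + 1) Y hY fun s _ => hfree s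
        by_contra! hlt
        have h2 := Nat.mul_le_mul_right (heavyBound (t + 1)) hlt.le
        simp only [chiOn, dichi] at *
        omega
      have hA' := hbd A hA
      have hB' := hbd B hB
      refine hpair (hr.hasPair_of_isLightBetween (m := 2 * m) hdom1 hdom2 (A := A) (B := B)
        (fun a ha b hb => ⟨?_, fun h => ?_, fun h => ?_⟩) (by omega) (by omega))
      · rintro rfl
        exact disjoint_left.1 hdisj ha hb
      · by_contra! h'
        exact hAB a ha b hb ((hr.heavyGraph_adj h).2 h')
      · by_contra! h'
        exact hAB a ha b hb ((hr.heavyGraph_adj h).2 h').symm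
    refine (hG.coverNumber_le_mul (X := univ) hP fun Y _ hY =>
      hr.dichi_le_of_arcNbhd hdom1 hdom2 (m := 2 * m) fun u hu v hv huv => ?_).trans
        (Nat.mul_le_mul_right _ hchi.le)
    by_contra! h'
    exact hY hu hv (hr.ne huv) ((hr.heavyGraph_adj huv).2 h')

/-- Vertices outside a `2c`-cluster `S` are sorted by their in-neighbours `Q` in `S`. One of `Q` and
`S \ Q` needs `c` colours and is complete to or from its class, so each of the at most `2 ^ l`
classes needs fewer than `c`. -/
theorem ElZaharErdosConjecture.nguyenScottSeymourConjecture (hEE : ElZaharErdosConjecture) :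
    NguyenScottSeymourConjecture := by
  classical
  intro c
  obtain ⟨l, d, hd⟩ := exists_dichi_le_of_not_hasCluster hEE c (2 * c)
  refine ⟨l + 2 ^ l * c + d + 1, fun V _ T hT hbig => ?_⟩
  have hr := hT.isTour
  have hP := hr.hereditary
  rw [hT.hasCompletePair_iff]
  rw [hT.dichromaticNumber_eq, Nat.cast_le] at hbig
  by_contra hno
  have hcl : HasCluster T.Adj (2 * c) l univ := by
    by_contra hcl
    have := hd V T.Adj hr hcl hno
    omega
  obtain ⟨S, _, hSl, hS⟩ := hcl
  have h1 := hP.coverNumber_le_add (X := univ) (A := (S : Set V))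
    (B := ⋃ Q ∈ S.powerset, {v | v ∉ S ∧ ∀ x ∈ S, x ∈ Q ↔ T.Adj x v}) fun v _ => by
      by_cases hv : v ∈ S
      · exact Or.inl hv
      · refine Or.inr (mem_biUnion (Finset.mem_powerset.2 (Finset.filter_subset
          (fun x => T.Adj x v) S)) ⟨hv, fun x hx => ?_⟩)
        simp [hx]
  have h2 := hP.coverNumber_le_card S
  have h3 := hP.coverNumber_biUnion_le (n := c) S.powerset
    (fun Q => {v | v ∉ S ∧ ∀ x ∈ S, x ∈ Q ↔ T.Adj x v}) fun Q hQ => by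
      by_contra! hc
      have hQS := Finset.mem_powerset.1 hQ
      have h4 := hP.coverNumber_le_add (X := (S : Set V)) (A := (Q : Set V))
        (B := ((S \ Q : Finset V) : Set V)) fun x hx => by
          by_cases hxQ : x ∈ Q
          · exact Or.inl hxQ
          · exact Or.inr (by simpa [hxQ] using hx)
      rcases le_or_gt c (dichi T.Adj (Q : Set V)) with h5 | h5
      · exact hno ⟨Q, _, h5, hc.le, fun x hx v hv => (hv.2 x (hQS hx)).1 hx⟩
      · refine hno ⟨_, ((S \ Q : Finset V) : Set V), hc.le, ?_, fun v hv x hx => ?_⟩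
        · simp only [dichi] at *
          omega
        · obtain ⟨hxS, hxQ⟩ := Finset.mem_sdiff.1 (Finset.mem_coe.1 hx)
          refine (hr.total ?_).resolve_right fun h => hxQ ((hv.2 x hxS).2 h)
          rintro rfl
          exact hv.1 hxS
  rw [Finset.card_powerset] at h3
  have h6 := Nat.mul_le_mul_right c (Nat.pow_le_pow_right two_pos hSl)
  simp only [dichi] at *
  omega

theorem NguyenScottSeymourConjecture.clusterFreeConjecture (h : NguyenScottSeymourConjecture)
    (s : ℕ → ℕ) : ClusterFreeConjecture s := by
  choose d hd using h
  refine ⟨fun _ c => d c, fun t c _ _ V _ T hT _ hpair => ?_⟩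
  by_contra! hlt
  exact hpair (hd c V T hT hlt.le)

theorem mainTheorem4 :
    (ElZaharErdosConjecture ↔ NguyenScottSeymourConjecture) ∧
    ∀ s : ℕ → ℕ, (∀ x : ℕ, 1 ≤ x → x ^ 2 * s (x - 1) + x ≤ s x) →
      (ElZaharErdosConjecture ↔ ClusterFreeConjecture s) :=
  ⟨⟨fun h => h.nguyenScottSeymourConjecture,
    -- Any function would serve in place of `id`.
    fun h => (h.clusterFreeConjecture id).elZaharErdosConjecture⟩,
    fun s _ => ⟨fun h => h.nguyenScottSeymourConjecture.clusterFreeConjecture s,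
      fun h => h.elZaharErdosConjecture⟩⟩
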